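/- Let $N>2$ and let $\Omega\subset\mathbb R^N$ be a bounded domain (open, connected) with Lipschitz boundary. Let $\vec p=(p_1,\dots,p_N)$ with $p_i>1$, put $p_i'=p_i/(p_i-1)$, let $\bar p$ be the harmonic mean, $\frac1{\bar p}=\frac1N\sum_{i=1}^N\frac1{p_i}$, and assume $\bar p<N$. Put $\bar p^*=\frac{N\bar p}{N-\bar p}$ and $p_\infty=\max\{\bar p^*,\max_i p_i\}$. Let $W_0^{1,\vec p}(\Omega)$ be the closure of $C_0^\infty(\Omega)$ in $W^{1,\vec p}(\Omega)=\{u\in W^{1,1}(\Omega):\partial_{x_i}u\in L^{p_i}(\Omega),\ i=1,\dots,N\}$ with respect to the norm $\|u\|_{L^1(\Omega)}+\sum_i\|\partial_{x_i}u\|_{L^{p_i}(\Omega)}$. Assume, for $i=1,\dots,N$: (H1) $\mathcal A_i:\Omega\times\mathbb R^N\to\mathbb R$ is a Carathéodory function and, for constants $0<\alpha\le\beta_i$, for a.e. $x\in\Omega$ and all $\xi,\eta\in\mathbb R^N$: $|\mathcal A_i(x,\xi)|\le\beta_i|\xi_i|^{p_i-1}$; $\ \alpha|\xi_i|^{p_i}\le\mathcal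 A_i(x,\xi)\,\xi_i$; and $0<(\mathcal A_i(x,\xi)-\mathcal A_i(x,\eta))(\xi_i-\eta_i)$ whenever $\xi_i\ne\eta_i$. (H2) $\mathcal B_i:\Omega\times\mathbb R\to\mathbb R$ is a Carathéodory function with $|\mathcal B_i(x,t)|\le b_i(x)|t|^{\bar p/p_i'}$ for a.e. $x\in\Omega$ and all $t\in\mathbb R$, where $b_i:\Omega\to[0,+\infty)$ is measurable and belongs to the Marcinkiewicz space $L^{Np_i'/\bar p,\infty}(\Omega)$, i.e. $\sup_{\tau>0}\tau^{q}\,|\{x\in\Omega:|b_i(x)|>\tau\}|<\infty$ with $q=Np_i'/\bar p$. (H3) $\mathcal G:\Omega\times\mathbb R\to\mathbb R$ is a Carathéodory function with $|\mathcal G(x,t)|\le\tilde\mu|t|^{\gamma}$ and $\mathcal G(x,t)\,t\ge0$ for a.e. $x\in\Omega$ and all $t\in\mathbb R$, where $\tilde\mu\ge0$ and $1\le\gamma<p_\infty-1$ are constants. Let $s_1,\dots,s_N$ be real numbers with $\mu:=\min_i\frac{s_i}{p_i'}>\frac N{\bar p}$, and let $b_i,f_i\in L^{s_i}(\Omega)$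 for $i=1,\dots,N$. A weak solution of the Dirichlet problem $$-\sum_{i=1}^N\partial_{x_i}\left[\mathcal A_i(x,\nabla u)+\mathcal B_i(x,u)\right]+\mathcal G(x,u)=-\sum_{i=1}^N\partial_{x_i}f_i\ \text{ in }\Omega,\qquad u=0\ \text{ on }\partial\Omega,\tag{P}$$ is a function $u\in W_0^{1,\vec p}(\Omega)$ such that, for every $\varphi\in C_0^\infty(\Omega)$, $$\int_\Omega\Big(\sum_{i=1}^N\left[\mathcal A_i(x,\nabla u)+\mathcal B_i(x,u)\right]\partial_{x_i}\varphi+\mathcal G(x,u)\,\varphi\Big)dx=\sum_{i=1}^N\int_\Omega f_i\,\partial_{x_i}\varphi\,dx .$$ **Lemma 4.2.** Every weak solution $u$ of (P) is (essentially) bounded, and there is a positive constant $C$, depending only on $\alpha$, $\Omega$, $N$, $\vec p$, the exponents $s_i$ and the norms $\|b_i\|_{L^{s_i}(\Omega)}$, $\|f_i\|_{L^{s_i}(\Omega)}$ ($i=1,\dots,N$), such that $\|u\|_{L^\infty(\Omega)}\le C$. -/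

import Mathlib

open MeasureTheory Filter Topology
open scoped ContDiff ENNReal NNReal

noncomputable section

namespace Aniso

/-- The Euclidean space `ℝ^N`. -/
abbrev E (N : ℕ) : Type := EuclideanSpace ℝ (Fin N)

/-- A bounded Lipschitz domain: a bounded, open, connected (nonempty) set which, near each point
of its boundary, is the part of a ball lying strictly above the graph of a Lipschitz function of
the `N - 1` variables orthogonal to some unit vector `e`. -/
structure IsBoundedLipschitzDomain {N : ℕ} (Ω : Set (E N)) : Prop where
  isOpen : IsOpen Ω
  isConnected : IsConnected Ω
  isBounded : Bornology.IsBounded Ω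
  lipschitz_boundary : ∀ x₀ ∈ frontier Ω, ∃ r : ℝ, 0 < r ∧ ∃ e : E N, ‖e‖ = 1 ∧
    ∃ (K : ℝ≥0) (g : E N → ℝ), LipschitzWith K g ∧
      Ω ∩ Metric.ball x₀ r =
        {x | g (x - inner ℝ e x • e) < inner ℝ e x} ∩ Metric.ball x₀ r

/-! ### Exponents -/

/-- The conjugate exponent `q' = q / (q - 1)`. -/
def conj (q : ℝ) : ℝ := q / (q - 1)

/-- The harmonic mean `p̄` of the exponents: `1 / p̄ = (1 / N) ∑ 1 / p_i`. -/
def pbar {N : ℕ} (p : Fin N → ℝ) : ℝ := ((1 / (N : ℝ)) * ∑ i, 1 / p i)⁻¹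

/-- The Sobolev exponent `p̄* = N p̄ / (N - p̄)`. -/
def pstar {N : ℕ} (p : Fin N → ℝ) : ℝ := (N : ℝ) * pbar p / ((N : ℝ) - pbar p)

/-- `p_∞ = max {p̄*, max_i p_i}`. -/
def pinfty {N : ℕ} (p : Fin N → ℝ) : ℝ := max (pstar p) (⨆ i, p i)

/-- `μ = min_i s_i / p_i'`. -/
def mu {N : ℕ} (p s : Fin N → ℝ) : ℝ := ⨅ i, s i / conj (p i)

/-! ### Function spaces -/

/-- The weak Lebesgue (Marcinkiewicz) space `L^{q,∞}(Ω)`. -/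
def MemWeakLp {N : ℕ} (f : E N → ℝ) (q : ℝ) (Ω : Set (E N)) : Prop :=
  AEMeasurable f (volume.restrict Ω) ∧
    (⨆ t : ℝ, ⨆ _ : 0 < t, ENNReal.ofReal (t ^ q) * volume {x | x ∈ Ω ∧ t < |f x|}) < ⊤

/-- The classical partial derivative `∂_i φ`. -/
def partialDeriv {N : ℕ} (i : Fin N) (φ : E N → ℝ) (x : E N) : ℝ :=
  fderiv ℝ φ x (EuclideanSpace.single i 1)

/-- `φ ∈ C_0^∞(Ω)`: smooth with compact support contained in `Ω`. -/
structure IsTest {N : ℕ} (Ω : Set (E N)) (φ : E N → ℝ) : Prop where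
  smooth : ContDiff ℝ ∞ φ
  compact_support : HasCompactSupport φ
  support_subset : tsupport φ ⊆ Ω

/-- `u ∈ W^{1,p⃗}(Ω)`, with weak gradient `Du`. -/
structure MemW {N : ℕ} (Ω : Set (E N)) (p : Fin N → ℝ) (u : E N → ℝ) (Du : E N → E N) :
    Prop where
  memLp_one : MemLp u 1 (volume.restrict Ω)
  memLp_grad : ∀ i, MemLp (fun x => Du x i) (ENNReal.ofReal (p i)) (volume.restrict Ω)
  weak_grad : ∀ i, ∀ φ, IsTest Ω φ →
    ∫ x in Ω, u x * partialDeriv i φ x = - ∫ x in Ω, Du x i * φ x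

/-- `u ∈ W_0^{1,p⃗}(Ω)`, with weak gradient `Du`: `u` belongs to the closure of `C_0^∞(Ω)` in
`W^{1,p⃗}(Ω)` for the norm `‖u‖_{L^1} + ∑ ‖∂_i u‖_{L^{p_i}}`. -/
structure MemW0 {N : ℕ} (Ω : Set (E N)) (p : Fin N → ℝ) (u : E N → ℝ) (Du : E N → E N) : Prop
    extends MemW Ω p u Du where
  approx : ∃ φ : ℕ → E N → ℝ, (∀ n, IsTest Ω (φ n)) ∧
    Tendsto (fun n => eLpNorm (fun x => u x - φ n x) 1 (volume.restrict Ω)) atTop (𝓝 0) ∧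
    ∀ i, Tendsto (fun n => eLpNorm (fun x => Du x i - partialDeriv i (φ n) x)
      (ENNReal.ofReal (p i)) (volume.restrict Ω)) atTop (𝓝 0)

/-! ### Structure conditions -/

/-- Carathéodory functions on `Ω × X`: (Lebesgue) measurable in the first variable for every
value of the second, continuous in the second variable for a.e. value of the first. -/
structure IsCaratheodory {N : ℕ} {X : Type} [TopologicalSpace X] (Ω : Set (E N))
    (h : E N → X → ℝ) : Prop where
  measurable : ∀ ξ, AEMeasurable (fun x => h x ξ) (volume.restrict Ω)
  continuous : ∀ᵐ x ∂(volume.restrict Ω), Continuous (h x)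

/-- Condition (H1) on the principal part, with constants `α` and `β_i`. -/
structure H1 {N : ℕ} (Ω : Set (E N)) (p : Fin N → ℝ) (α : ℝ) (β : Fin N → ℝ)
    (A : Fin N → E N → E N → ℝ) : Prop where
  alpha_pos : 0 < α
  alpha_le : ∀ i, α ≤ β i
  caratheodory : ∀ i, IsCaratheodory Ω (A i)
  growth : ∀ i, ∀ᵐ x ∂(volume.restrict Ω), ∀ ξ : E N, |A i x ξ| ≤ β i * |ξ i| ^ (p i - 1)
  coercive : ∀ i, ∀ᵐ x ∂(volume.restrict Ω), ∀ ξ : E N, α * |ξ i| ^ p i ≤ A i x ξ * ξ i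
  monotone : ∀ i, ∀ᵐ x ∂(volume.restrict Ω), ∀ ξ η : E N, ξ i ≠ η i →
    0 < (A i x ξ - A i x η) * (ξ i - η i)

/-- Condition (H2) on the first-order term, with coefficients `b_i`. -/
structure H2 {N : ℕ} (Ω : Set (E N)) (p : Fin N → ℝ) (b : Fin N → E N → ℝ)
    (B : Fin N → E N → ℝ → ℝ) : Prop where
  caratheodory : ∀ i, IsCaratheodory Ω (B i)
  growth : ∀ i, ∀ᵐ x ∂(volume.restrict Ω), ∀ t : ℝ,
    |B i x t| ≤ b i x * |t| ^ (pbar p / conj (p i))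
  coeff_nonneg : ∀ i, ∀ x ∈ Ω, 0 ≤ b i x
  coeff_mem : ∀ i, MemWeakLp (b i) ((N : ℝ) * conj (p i) / pbar p) Ω

/-- Condition (H3) on the zero-order term, with constants `m` and `γ`. -/
structure H3 {N : ℕ} (Ω : Set (E N)) (p : Fin N → ℝ) (m γ : ℝ) (G : E N → ℝ → ℝ) : Prop where
  caratheodory : IsCaratheodory Ω G
  const_nonneg : 0 ≤ m
  one_le : 1 ≤ γ
  lt_pinfty : γ < pinfty p - 1
  growth : ∀ᵐ x ∂(volume.restrict Ω), ∀ t : ℝ, |G x t| ≤ m * |t| ^ γ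
  sign : ∀ᵐ x ∂(volume.restrict Ω), ∀ t : ℝ, 0 ≤ G x t * t

/-! ### The Dirichlet problem -/

/-- The functional `F = - ∑ ∂_i f_i`, that is `⟨F, φ⟩ = ∑ ∫_Ω f_i ∂_i φ`. -/
def divFunctional {N : ℕ} (Ω : Set (E N)) (f : Fin N → E N → ℝ) (φ : E N → ℝ) : ℝ :=
  ∑ i, ∫ x in Ω, f i x * partialDeriv i φ x

/-- `u` is a weak solution of `- ∑ ∂_i [A_i(x, ∇u) + B_i(x, u)] + G(x, u) = F` in `Ω`, `u = 0` on
`∂Ω`. The weak gradient `Du` of `u` is unique up to equality a.e. in `Ω`. -/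
def IsWeakSolution {N : ℕ} (Ω : Set (E N)) (p : Fin N → ℝ) (A : Fin N → E N → E N → ℝ)
    (B : Fin N → E N → ℝ → ℝ) (G : E N → ℝ → ℝ) (F : (E N → ℝ) → ℝ) (u : E N → ℝ) : Prop :=
  ∃ Du : E N → E N, MemW0 Ω p u Du ∧ ∀ φ, IsTest Ω φ →
    ∫ x in Ω, ((∑ i, (A i x (Du x) + B i x (u x)) * partialDeriv i φ x) + G x (u x) * φ x)
      = F φ

/-- The norm of `f` in `L^q(Ω)`, as a real number. -/
def lpNormOn {N : ℕ} (Ω : Set (E N)) (q : ℝ) (f : E N → ℝ) : ℝ :=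
  (eLpNorm f (ENNReal.ofReal q) (volume.restrict Ω)).toReal

end Aniso

end

/-!
# Boundedness of solutions: the idea

Let `a(k) = |{x ∈ Ω : k < |u(x)|}|`. The solution is tested with smooth truncations `ψ(u)` which
vary only where `k < |u| < h`, with slope at most a constant `c` not depending on `k, h`. Since
`G(x, u) ψ(u) ≥ 0`, since `|u| ≤ h` where `ψ'(u) ≠ 0`, and by Young's inequality, for `k ≥ 1`
`∫ ψ'(u) |∂_i u|^{p_i} ≤ C h^{p̄} ∫_{k<|u|<h} g`, where `g = ∑ (b_i^{p_i'} + |f_i|^{p_i'})`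
(`Aniso.energy_le`). The only Sobolev inequality in use is
`‖v‖_{L^{N/(N-1)}} ≤ N ∏ ‖∂_i v‖_{L^1}^{1/N}`, which follows from Mathlib's
Gagliardo–Nirenberg–Sobolev inequality by dilating the axes separately. Applied to `ψ(u)` and
combined with Hölder's inequality in each direction
(`Aniso.MemW0.distrib_le_of_energy_le`), it gives

`(h - k) a(h)^{1-1/N} ≤ C h (∫_{k<|u|<h} g)^{1/p̄} a(k)^{1-1/p̄}`.

This is used twice. The dyadic slabs `2^j < |u| < 2^{j+1}` are disjoint, so that among the first
`J` of them `g` has integral at most `‖g‖_1 / J` over one; hence `a(2^J)` is as small as desired for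
`J` depending on the data only (`Aniso.exists_distrib_le`). This replaces an a priori bound for
`u`, and no smallness of the `b_i` is needed. Next, `∫_{k<|u|} g ≤ Λ a(k)^{1-1/μ}`, and
`1 - 1/(μ p̄) > 1 - 1/N` because `μ > N/p̄`, so that De Giorgi's iteration makes `a` vanish at a
finite level (`Aniso.exists_threshold`).

To test with `ψ(u)`, approximate `u` by `φ_n ∈ C_0^∞(Ω)`. The functions `ψ ∘ φ_n` are again test
functions, and their gradients `ψ'(φ_n) ∇φ_n` converge weakly to `ψ'(u) ∇u`, so no chain rule for
weak derivatives is required. The passage to the limit does require `B_i(x, u) ∈ L^{p_i'}` and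
`G(x, u) ∈ L^1`; these follow from `u ∈ L^r` for all `r < p_∞`, where the range `r < p̄*` comes from
the level-set inequality once more (a weak-type Sobolev embedding), and the integrability of
`|u|^{p_i}` from the one-directional Poincaré inequality.
-/

namespace Aniso

/-! ### The anisotropic Gagliardo–Nirenberg inequality for test functions -/

/-- The linear map `y ↦ (y_i / X_i)_i`, from `ℝ^N` with the sup norm to Euclidean space. -/
noncomputable def scaleMap {N : ℕ} (X : Fin N → ℝ) : (Fin N → ℝ) →L[ℝ] E N :=
  (PiLp.continuousLinearEquiv 2 ℝ (fun _ : Fin N => ℝ)).symm.toContinuousLinearMap.comp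
    (ContinuousLinearMap.pi fun i => (X i)⁻¹ • ContinuousLinearMap.proj i)

lemma scaleMap_apply {N : ℕ} (X : Fin N → ℝ) (y : Fin N → ℝ) :
    scaleMap X y = WithLp.toLp 2 (fun i => (X i)⁻¹ * y i) := rfl

lemma scaleMap_single {N : ℕ} (X : Fin N → ℝ) (i : Fin N) :
    scaleMap X (Pi.single i 1) = (X i)⁻¹ • EuclideanSpace.single i (1 : ℝ) := by
  rw [scaleMap_apply]
  ext j
  by_cases h : j = i
  · subst h; simp
  · simp [h]

lemma lintegral_comp_scaleMap {N : ℕ} {X : Fin N → ℝ} (hX : ∀ i, 0 < X i) {f : E N → ℝ≥0∞}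
    (hf : Measurable f) :
    ∫⁻ y, f (scaleMap X y) = ENNReal.ofReal (∏ i, X i) * ∫⁻ x, f x := by
  have hP : 0 < ∏ i, X i := Finset.prod_pos fun i _ => hX i
  have hdet : (Matrix.diagonal fun i => (X i)⁻¹).det ≠ 0 := by
    rw [Matrix.det_diagonal, Finset.prod_inv_distrib]
    exact inv_ne_zero hP.ne'
  have h1 : ∫⁻ x, f x = ∫⁻ z : Fin N → ℝ, f (WithLp.toLp 2 z) :=
    ((PiLp.volume_preserving_toLp (Fin N)).lintegral_comp hf).symm
  have hm : Measurable fun z : Fin N → ℝ => f (WithLp.toLp 2 z) :=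
    hf.comp (PiLp.volume_preserving_toLp (Fin N)).measurable
  have hd : Measurable (Matrix.toLin' (Matrix.diagonal fun i => (X i)⁻¹)) :=
    (LinearMap.continuous_on_pi _).measurable
  have h2 : ∫⁻ z : Fin N → ℝ, f (WithLp.toLp 2 z) = ENNReal.ofReal (∏ i, X i)⁻¹ *
      ∫⁻ y : Fin N → ℝ, f (scaleMap X y) := by
    conv_lhs => rw [← Real.smul_map_diagonal_volume_pi hdet]
    rw [lintegral_smul_measure, lintegral_map hm hd, Matrix.det_diagonal, Finset.prod_inv_distrib,
      abs_of_pos (inv_pos.2 hP), smul_eq_mul]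
    congr 1
    refine lintegral_congr fun y => ?_
    rw [scaleMap_apply]
    congr 2
    ext i
    simp [Matrix.mulVec_diagonal]
  rw [h1, h2, ← mul_assoc, ← ENNReal.ofReal_mul hP.le, mul_inv_cancel₀ hP.ne', ENNReal.ofReal_one,
    one_mul]

lemma enorm_le_sum_enorm_single {N : ℕ} (l : (Fin N → ℝ) →L[ℝ] ℝ) :
    ‖l‖ₑ ≤ ∑ i, ‖l (Pi.single i 1)‖ₑ := by
  have h : ‖l‖ ≤ ∑ i, ‖l (Pi.single i 1)‖ := by
    refine l.opNorm_le_bound (Finset.sum_nonneg fun _ _ => norm_nonneg _) fun y => ?_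
    have hy : l y = ∑ i, y i * l (Pi.single i 1) := by
      conv_lhs => rw [pi_eq_sum_univ' y]
      simp [map_sum]
    rw [hy, Finset.sum_mul]
    refine (norm_sum_le _ _).trans (Finset.sum_le_sum fun i _ => ?_)
    rw [norm_mul, mul_comm]
    exact mul_le_mul_of_nonneg_left (norm_le_pi_norm y i) (norm_nonneg _)
  calc ‖l‖ₑ = ENNReal.ofReal ‖l‖ := (ofReal_norm _).symm
    _ ≤ ENNReal.ofReal (∑ i, ‖l (Pi.single i 1)‖) := ENNReal.ofReal_le_ofReal h
    _ = ∑ i, ‖l (Pi.single i 1)‖ₑ := by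
      rw [ENNReal.ofReal_sum_of_nonneg fun _ _ => norm_nonneg _]
      simp only [ofReal_norm]

lemma continuous_partialDeriv {N : ℕ} {v : E N → ℝ} (hv : ContDiff ℝ 1 v) (i : Fin N) :
    Continuous (partialDeriv i v) :=
  (hv.continuous_fderiv one_ne_zero).clm_apply continuous_const

/-- The isotropic inequality for the rescaled function `y ↦ v (y_i / X_i)`: dilating each axis by
its own factor turns the sum of the `‖∂_i v‖_{L^1}` into their product. -/
lemma lintegral_rpow_le_of_lintegral_partialDeriv_le {N : ℕ} (hN : 2 ≤ N) {v : E N → ℝ}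
    (hv : ContDiff ℝ 1 v) (hc : HasCompactSupport v) {X : Fin N → ℝ} (hX : ∀ i, 0 < X i)
    (hD : ∀ i, ∫⁻ x, ‖partialDeriv i v x‖ₑ ≤ ENNReal.ofReal (X i)) :
    ∫⁻ x, ‖v x‖ₑ ^ ((N : ℝ) / (N - 1)) ≤
      ENNReal.ofReal ((N * ∏ i, X i ^ (1 / (N : ℝ))) ^ ((N : ℝ) / (N - 1))) := by
  have hN' : (2 : ℝ) ≤ N := by exact_mod_cast hN
  set q : ℝ := (N : ℝ) / (N - 1) with hq
  have hq0 : 0 < q := div_pos (by linarith) (by linarith)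
  have hconj : Real.HolderConjugate (Fintype.card (Fin N)) q := by
    rw [Fintype.card_fin]
    exact Real.HolderConjugate.conjExponent (by linarith)
  have hP : 0 < ∏ i, X i := Finset.prod_pos fun i _ => hX i
  set w : (Fin N → ℝ) → ℝ := v ∘ scaleMap X with hw
  have hwd : ContDiff ℝ 1 w := hv.comp (scaleMap X).contDiff
  let e : (Fin N → ℝ) ≃ₜ E N :=
    { toFun := scaleMap X
      invFun := fun x i => X i * x i
      left_inv := fun y => by ext i; simp [scaleMap_apply, (hX i).ne']
      right_inv := fun x => by ext i; simp [scaleMap_apply, (hX i).ne']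
      continuous_toFun := (scaleMap X).continuous
      continuous_invFun := by fun_prop }
  have hwc : HasCompactSupport w := hc.comp_homeomorph e
  have key := lintegral_pow_le_pow_lintegral_fderiv_aux hconj hwd hwc
  have hvm : Measurable fun x => ‖v x‖ₑ ^ q := by
    have := hv.continuous.measurable; fun_prop
  have h1 : ∫⁻ y, ‖w y‖ₑ ^ q = ENNReal.ofReal (∏ i, X i) * ∫⁻ x, ‖v x‖ₑ ^ q :=
    lintegral_comp_scaleMap hX hvm
  have h2 : ∫⁻ y, ‖fderiv ℝ w y‖ₑ ≤ ENNReal.ofReal (N * ∏ i, X i) := by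
    have hpt : ∀ y, ‖fderiv ℝ w y‖ₑ ≤
        ∑ i, ENNReal.ofReal (X i)⁻¹ * ‖partialDeriv i v (scaleMap X y)‖ₑ := fun y => by
      refine (enorm_le_sum_enorm_single _).trans_eq (Finset.sum_congr rfl fun i _ => ?_)
      have : fderiv ℝ w y = (fderiv ℝ v (scaleMap X y)).comp (scaleMap X) :=
        ((hv.differentiable one_ne_zero _).hasFDerivAt.comp y
          (scaleMap X).hasFDerivAt).fderiv
      rw [this, ContinuousLinearMap.comp_apply, scaleMap_single, map_smul, smul_eq_mul, enorm_mul,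
        Real.enorm_of_nonneg (inv_nonneg.2 (hX i).le)]
      rfl
    have hm : ∀ i, Measurable fun x => ‖partialDeriv i v x‖ₑ := fun i =>
      (continuous_partialDeriv hv i).measurable.enorm
    calc ∫⁻ y, ‖fderiv ℝ w y‖ₑ
        ≤ ∫⁻ y, ∑ i, ENNReal.ofReal (X i)⁻¹ * ‖partialDeriv i v (scaleMap X y)‖ₑ :=
          lintegral_mono hpt
      _ = ∑ i, ENNReal.ofReal (X i)⁻¹ *
            (ENNReal.ofReal (∏ j, X j) * ∫⁻ x, ‖partialDeriv i v x‖ₑ) := by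
          rw [lintegral_finsetSum]
          · refine Finset.sum_congr rfl fun i _ => ?_
            rw [lintegral_const_mul' _ _ ENNReal.ofReal_ne_top, lintegral_comp_scaleMap hX (hm i)]
          · exact fun i _ => ((hm i).comp (scaleMap X).continuous.measurable).const_mul _
      _ ≤ ∑ i : Fin N, ENNReal.ofReal (∏ j, X j) := by
          refine Finset.sum_le_sum fun i _ => ?_
          calc _ ≤ ENNReal.ofReal (X i)⁻¹ * (ENNReal.ofReal (∏ j, X j) * ENNReal.ofReal (X i)) := by
                gcongr; exact hD i
            _ = ENNReal.ofReal (∏ j, X j) := by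
                rw [← ENNReal.ofReal_mul hP.le, ← ENNReal.ofReal_mul (inv_nonneg.2 (hX i).le)]
                congr 1
                have := (hX i).ne'
                field_simp
      _ = ENNReal.ofReal (N * ∏ i, X i) := by
          rw [ENNReal.ofReal_mul (by positivity)]
          simp
  have h3 : ENNReal.ofReal (∏ i, X i) * ∫⁻ x, ‖v x‖ₑ ^ q ≤
      ENNReal.ofReal ((N * ∏ i, X i) ^ q) := by
    rw [← h1]
    refine key.trans ?_
    rw [← ENNReal.ofReal_rpow_of_nonneg (by positivity) hq0.le]
    exact ENNReal.rpow_le_rpow h2 hq0.le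
  have h4 : (N * ∏ i, X i) ^ q = (∏ i, X i) * (N * ∏ i, X i ^ (1 / (N : ℝ))) ^ q := by
    rw [Real.finsetProd_rpow _ _ fun i _ => (hX i).le, Real.mul_rpow (by positivity) hP.le,
      Real.mul_rpow (by positivity) (by positivity), ← Real.rpow_mul hP.le, mul_left_comm]
    congr 1
    nth_rewrite 2 [← Real.rpow_one (∏ i, X i)]
    rw [← Real.rpow_add hP]
    congr 1
    have : (N : ℝ) - 1 ≠ 0 := by linarith
    rw [hq]; field_simp; ring
  rw [h4, ENNReal.ofReal_mul hP.le] at h3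
  exact (ENNReal.mul_le_mul_iff_right (by simpa using hP) ENNReal.ofReal_ne_top).1 h3

lemma hasCompactSupport_partialDeriv {N : ℕ} {v : E N → ℝ} (hc : HasCompactSupport v)
    (i : Fin N) : HasCompactSupport (partialDeriv i v) :=
  hc.fderiv_apply ℝ (EuclideanSpace.single i 1)

/-- The anisotropic Gagliardo–Nirenberg inequality
`‖v‖_{L^{N/(N-1)}} ≤ N ∏ ‖∂_i v‖_{L^1}^{1/N}`. -/
theorem lintegral_rpow_le_prod_integral_partialDeriv {N : ℕ} (hN : 2 ≤ N) {v : E N → ℝ}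
    (hv : ContDiff ℝ 1 v) (hc : HasCompactSupport v) :
    ∫⁻ x, ‖v x‖ₑ ^ ((N : ℝ) / (N - 1)) ≤
      ENNReal.ofReal ((N * ∏ i, (∫ x, |partialDeriv i v x|) ^ (1 / (N : ℝ))) ^
        ((N : ℝ) / (N - 1))) := by
  have hN' : (2 : ℝ) ≤ N := by exact_mod_cast hN
  have hint : ∀ i, Integrable (partialDeriv i v) := fun i =>
    (continuous_partialDeriv hv i).integrable_of_hasCompactSupport
      (hasCompactSupport_partialDeriv hc i)
  -- The dilations need positive factors: add `ε` to each integral, and let `ε → 0`.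
  have hlim : Tendsto (fun ε : ℝ => ENNReal.ofReal
      ((N * ∏ i, ((∫ x, |partialDeriv i v x|) + ε) ^ (1 / (N : ℝ))) ^ ((N : ℝ) / (N - 1))))
      (𝓝[>] 0) (𝓝 (ENNReal.ofReal ((N * ∏ i, ((∫ x, |partialDeriv i v x|) + 0) ^ (1 / (N : ℝ))) ^
        ((N : ℝ) / (N - 1))))) := by
    refine Tendsto.mono_left ?_ nhdsWithin_le_nhds
    refine ENNReal.tendsto_ofReal (Tendsto.rpow_const (Tendsto.const_mul _
      (tendsto_finsetProd _ fun i _ => ?_)) (Or.inr (div_nonneg (by linarith) (by linarith))))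
    exact (tendsto_const_nhds.add tendsto_id).rpow_const (Or.inr (by positivity))
  simp only [add_zero] at hlim
  refine ge_of_tendsto hlim ?_
  filter_upwards [self_mem_nhdsWithin] with ε hε
  have hε : 0 < ε := hε
  have h0 : ∀ i, 0 ≤ ∫ x, |partialDeriv i v x| := fun i => integral_nonneg fun x => abs_nonneg _
  refine lintegral_rpow_le_of_lintegral_partialDeriv_le hN hv hc
    (fun i => by linarith [h0 i]) fun i => ?_
  rw [← ofReal_integral_norm_eq_lintegral_enorm (hint i)]
  exact ENNReal.ofReal_le_ofReal (by simpa using hε.le)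

/-! ### Smooth truncations -/

/-- `ψ` is a smooth truncation at the levels `0 < k < h`, with slopes between `0` and `c`: it is
flat, hence `0`, on `[-k, k]`, has modulus `h - k` outside `(-h, h)`, and has the sign of its
argument. -/
structure IsCutoff (c k h : ℝ) (ψ : ℝ → ℝ) : Prop where
  smooth : ContDiff ℝ ∞ ψ
  zero : ψ 0 = 0
  abs_le : ∀ t, |ψ t| ≤ h - k
  mul_nonneg : ∀ t, 0 ≤ ψ t * t
  abs_eq : ∀ t, h ≤ |t| → |ψ t| = h - k
  deriv_nonneg : ∀ t, 0 ≤ deriv ψ t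
  deriv_le : ∀ t, deriv ψ t ≤ c
  deriv_ne : ∀ t, deriv ψ t ≠ 0 → k < |t| ∧ |t| < h

lemma deriv_smoothTransition_of_nonpos {t : ℝ} (ht : t ≤ 0) : deriv Real.smoothTransition t = 0 :=
  IsLocalMin.deriv_eq_zero <| Eventually.of_forall fun s => by
    rw [Real.smoothTransition.zero_of_nonpos ht]; exact Real.smoothTransition.nonneg s

lemma deriv_smoothTransition_of_one_le {t : ℝ} (ht : 1 ≤ t) : deriv Real.smoothTransition t = 0 :=
  IsLocalMax.deriv_eq_zero <| Eventually.of_forall fun s => by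
    rw [Real.smoothTransition.one_of_one_le ht]; exact Real.smoothTransition.le_one s

/-- The bound on the slope of a smooth truncation can be taken independent of the levels. -/
lemma exists_isCutoff : ∃ c : ℝ, 0 < c ∧ ∀ k h : ℝ, 0 < k → k < h → ∃ ψ, IsCutoff c k h ψ := by
  have hS : ContDiff ℝ ∞ Real.smoothTransition := Real.smoothTransition.contDiff
  have hSd : Differentiable ℝ Real.smoothTransition := hS.differentiable (by simp)
  have hS' : Continuous (deriv Real.smoothTransition) := hS.continuous_deriv (by simp)
  obtain ⟨M, hM⟩ := (isCompact_Icc (a := (0 : ℝ)) (b := 1)).bddAbove_image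
    hS'.continuousOn
  have hb : ∀ t, deriv Real.smoothTransition t ≤ max M 1 := fun t => by
    rcases le_total t 0 with h | h
    · rw [deriv_smoothTransition_of_nonpos h]; positivity
    rcases le_total 1 t with h' | h'
    · rw [deriv_smoothTransition_of_one_le h']; positivity
    exact (hM ⟨t, ⟨h, h'⟩, rfl⟩).trans (le_max_left _ _)
  have hn : ∀ t, 0 ≤ deriv Real.smoothTransition t := fun t =>
    Real.smoothTransition.monotone.deriv_nonneg
  refine ⟨2 * max M 1, by positivity, fun k h hk hkh => ?_⟩
  have hd : 0 < h - k := sub_pos.2 hkh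
  set ψ : ℝ → ℝ := fun t => (h - k) *
    (Real.smoothTransition ((t - k) / (h - k)) - Real.smoothTransition ((-t - k) / (h - k))) with hψ
  have hz1 : ∀ t, t ≤ k → Real.smoothTransition ((t - k) / (h - k)) = 0 := fun t ht =>
    Real.smoothTransition.zero_of_nonpos (div_nonpos_of_nonpos_of_nonneg (by linarith) hd.le)
  have hz2 : ∀ t, h ≤ t → Real.smoothTransition ((t - k) / (h - k)) = 1 := fun t ht =>
    Real.smoothTransition.one_of_one_le ((one_le_div hd).2 (by linarith))
  have hder : ∀ t, deriv ψ t = deriv Real.smoothTransition ((t - k) / (h - k)) +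
      deriv Real.smoothTransition ((-t - k) / (h - k)) := fun t => by
    have h1 : HasDerivAt (fun t : ℝ => (t - k) / (h - k)) (1 / (h - k)) t :=
      ((hasDerivAt_id t).sub_const k).div_const _
    have h2 : HasDerivAt (fun t : ℝ => (-t - k) / (h - k)) (-1 / (h - k)) t :=
      ((hasDerivAt_id t).neg.sub_const k).div_const _
    have h3 := ((hSd _).hasDerivAt.comp t h1).sub ((hSd _).hasDerivAt.comp t h2)
    have h4 := (h3.const_mul (h - k)).deriv
    refine h4.trans ?_
    field_simp
    ring
  refine ⟨ψ, ?_, ?_, ?_, ?_, ?_, ?_, ?_, ?_⟩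
  · refine contDiff_const.mul ((hS.comp ?_).sub (hS.comp ?_))
    · exact (contDiff_id.sub contDiff_const).div_const _
    · exact (contDiff_id.neg.sub contDiff_const).div_const _
  · simp [hψ]
  · intro t
    rw [hψ]
    simp only
    rw [abs_mul, abs_of_pos hd]
    refine mul_le_of_le_one_right hd.le (abs_le.2 ⟨?_, ?_⟩)
    · linarith [Real.smoothTransition.nonneg ((t - k) / (h - k)),
        Real.smoothTransition.le_one ((-t - k) / (h - k))]
    · linarith [Real.smoothTransition.nonneg ((-t - k) / (h - k)),
        Real.smoothTransition.le_one ((t - k) / (h - k))]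
  · intro t
    rcases le_total t 0 with ht | ht
    · have := Real.smoothTransition.nonneg ((-t - k) / (h - k))
      simp only [hψ]
      rw [hz1 t (by linarith)]
      nlinarith [mul_nonneg (mul_nonneg hd.le this) (neg_nonneg.2 ht)]
    · have := Real.smoothTransition.nonneg ((t - k) / (h - k))
      simp only [hψ]
      rw [hz1 (-t) (by linarith), sub_zero]
      positivity
  · intro t ht
    simp only [hψ]
    rcases le_total t 0 with h0 | h0
    · rw [abs_of_nonpos h0] at ht
      rw [hz1 t (by linarith), hz2 (-t) ht, zero_sub, mul_neg, mul_one, abs_neg, abs_of_pos hd]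
    · rw [abs_of_nonneg h0] at ht
      rw [hz2 t ht, hz1 (-t) (by linarith), sub_zero, mul_one, abs_of_pos hd]
  · intro t
    rw [hder]; exact add_nonneg (hn _) (hn _)
  · intro t
    rw [hder]; linarith [hb ((t - k) / (h - k)), hb ((-t - k) / (h - k))]
  · have aux : ∀ t, deriv Real.smoothTransition ((t - k) / (h - k)) ≠ 0 → k < |t| ∧ |t| < h := by
      intro t ht
      have h1 : k < t := by
        by_contra hc
        exact ht (deriv_smoothTransition_of_nonpos
          (div_nonpos_of_nonpos_of_nonneg (by linarith) hd.le))
      have h2 : t < h := by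
        by_contra hc
        exact ht (deriv_smoothTransition_of_one_le ((one_le_div hd).2 (by linarith)))
      rw [abs_of_pos (hk.trans h1)]
      exact ⟨h1, h2⟩
    intro t ht
    rw [hder] at ht
    by_cases h1 : deriv Real.smoothTransition ((t - k) / (h - k)) = 0
    · rw [h1, zero_add] at ht
      simpa using aux (-t) ht
    · exact aux t h1

lemma IsCutoff.continuous_deriv {c k h : ℝ} {ψ : ℝ → ℝ} (hψ : IsCutoff c k h ψ) :
    Continuous (deriv ψ) := hψ.smooth.continuous_deriv (by simp)

lemma IsCutoff.abs_deriv_le {c k h : ℝ} {ψ : ℝ → ℝ} (hψ : IsCutoff c k h ψ) (t : ℝ) :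
    |deriv ψ t| ≤ c := by rw [abs_of_nonneg (hψ.deriv_nonneg t)]; exact hψ.deriv_le t

/-! ### Test functions and their compositions with truncations -/

lemma IsTest.comp {N : ℕ} {Ω : Set (E N)} {φ : E N → ℝ} (hφ : IsTest Ω φ) {ψ : ℝ → ℝ}
    (hψ : ContDiff ℝ ∞ ψ) (h0 : ψ 0 = 0) : IsTest Ω (ψ ∘ φ) where
  smooth := hψ.comp hφ.smooth
  compact_support := hφ.compact_support.comp_left h0
  support_subset := (closure_mono (Function.support_comp_subset h0 φ)).trans hφ.support_subset

lemma IsTest.partialDeriv_comp {N : ℕ} {Ω : Set (E N)} {φ : E N → ℝ} (hφ : IsTest Ω φ) {ψ : ℝ → ℝ}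
    (hψ : ContDiff ℝ ∞ ψ) (i : Fin N) (x : E N) :
    partialDeriv i (ψ ∘ φ) x = deriv ψ (φ x) * partialDeriv i φ x := by
  have h1 := (hψ.differentiable (by simp) (φ x)).hasDerivAt.comp_hasFDerivAt x
    (hφ.smooth.differentiable (by simp) x).hasFDerivAt
  simp [partialDeriv, h1.fderiv]

lemma IsTest.contDiff_one {N : ℕ} {Ω : Set (E N)} {φ : E N → ℝ} (hφ : IsTest Ω φ) :
    ContDiff ℝ 1 φ := hφ.smooth.of_le (by simp)

lemma IsTest.continuous_partialDeriv {N : ℕ} {Ω : Set (E N)} {φ : E N → ℝ} (hφ : IsTest Ω φ)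
    (i : Fin N) : Continuous (partialDeriv i φ) := Aniso.continuous_partialDeriv hφ.contDiff_one i

lemma IsTest.memLp_partialDeriv {N : ℕ} {Ω : Set (E N)} {φ : E N → ℝ} (hφ : IsTest Ω φ)
    (i : Fin N) (p : ℝ≥0∞) : MemLp (partialDeriv i φ) p (volume.restrict Ω) :=
  ((hφ.continuous_partialDeriv i).memLp_of_hasCompactSupport
    (hasCompactSupport_partialDeriv hφ.compact_support i)).restrict _

lemma IsTest.memLp {N : ℕ} {Ω : Set (E N)} {φ : E N → ℝ} (hφ : IsTest Ω φ)
    (p : ℝ≥0∞) : MemLp φ p (volume.restrict Ω) :=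
  (hφ.smooth.continuous.memLp_of_hasCompactSupport hφ.compact_support).restrict _

lemma IsTest.support_partialDeriv_subset {N : ℕ} {Ω : Set (E N)} {φ : E N → ℝ} (hφ : IsTest Ω φ)
    (i : Fin N) : Function.support (partialDeriv i φ) ⊆ Ω := fun x hx => by
  refine hφ.support_subset (support_fderiv_subset ℝ (f := φ) fun h => hx ?_)
  simp [partialDeriv, h]

/-- The defining approximation of a function of `W_0^{1,p⃗}`, along a subsequence which converges
almost everywhere. -/
lemma MemW0.exists_approx {N : ℕ} {Ω : Set (E N)} {p : Fin N → ℝ} {u : E N → ℝ} {Du : E N → E N}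
    (hu : MemW0 Ω p u Du) : ∃ φ : ℕ → E N → ℝ, (∀ n, IsTest Ω (φ n)) ∧
      (∀ᵐ x ∂(volume.restrict Ω), Tendsto (fun n => φ n x) atTop (𝓝 (u x))) ∧
      ∀ i, Tendsto (fun n => eLpNorm (fun x => partialDeriv i (φ n) x - Du x i)
        (ENNReal.ofReal (p i)) (volume.restrict Ω)) atTop (𝓝 0) := by
  obtain ⟨φ, hφ, h1, h2⟩ := hu.approx
  have hm : TendstoInMeasure (volume.restrict Ω) φ atTop u := by
    refine tendstoInMeasure_of_tendsto_eLpNorm one_ne_zero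
      (fun n => ((hφ n).memLp 1).1) hu.memLp_one.1 ?_
    refine h1.congr fun n => ?_
    rw [← eLpNorm_neg]
    congr 1
    ext x
    simp
  obtain ⟨ns, hns, hae⟩ := hm.exists_seq_tendsto_ae
  refine ⟨fun n => φ (ns n), fun n => hφ _, hae, fun i => ?_⟩
  refine ((h2 i).comp hns.tendsto_atTop).congr fun n => ?_
  simp only [Function.comp]
  rw [← eLpNorm_neg]
  congr 1
  ext x
  simp

lemma holderTriple_ofReal {p q : ℝ} (hpq : p.HolderConjugate q) :
    ENNReal.HolderTriple (ENNReal.ofReal p) (ENNReal.ofReal q) 1 :=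
  ⟨by
    rw [inv_one, ← ENNReal.ofReal_inv_of_pos hpq.pos, ← ENNReal.ofReal_inv_of_pos hpq.symm.pos,
      ← ENNReal.ofReal_add (inv_nonneg.2 hpq.nonneg) (inv_nonneg.2 hpq.symm.nonneg),
      hpq.inv_add_inv_eq_one, ENNReal.ofReal_one]⟩

/-- Strong convergence in `L^p`, multiplied by bounded almost everywhere convergence, still
converges weakly: the pairings with a function of the dual space converge. -/
lemma tendsto_integral_mul_mul {X : Type*} [MeasurableSpace X] {μ : Measure X} {p q : ℝ}
    (hpq : p.HolderConjugate q) {g F w : X → ℝ} {Fn wn : ℕ → X → ℝ} {L : ℝ}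
    (hg : MemLp g (ENNReal.ofReal q) μ) (hF : MemLp F (ENNReal.ofReal p) μ)
    (hFn : ∀ n, MemLp (Fn n) (ENNReal.ofReal p) μ)
    (hlim : Tendsto (fun n => eLpNorm (fun x => Fn n x - F x) (ENNReal.ofReal p) μ) atTop (𝓝 0))
    (hwn : ∀ n, AEStronglyMeasurable (wn n) μ) (hL : ∀ n x, |wn n x| ≤ L)
    (hw : ∀ᵐ x ∂μ, Tendsto (fun n => wn n x) atTop (𝓝 (w x))) :
    Tendsto (fun n => ∫ x, g x * (wn n x * Fn n x) ∂μ) atTop (𝓝 (∫ x, g x * (w x * F x) ∂μ)) := by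
  have := holderTriple_ofReal hpq.symm
  have hD : ∀ n, MemLp (fun x => Fn n x - F x) (ENNReal.ofReal p) μ := fun n => (hFn n).sub hF
  have hgD : ∀ n, Integrable (fun x => g x * (Fn n x - F x)) μ := fun n =>
    memLp_one_iff_integrable.1 ((hD n).mul hg)
  have hgF : Integrable (fun x => g x * F x) μ := memLp_one_iff_integrable.1 (hF.mul hg)
  have hi1 : ∀ n, Integrable (fun x => wn n x * (g x * (Fn n x - F x))) μ := fun n =>
    (hgD n).bdd_mul (hwn n) (Eventually.of_forall fun x => hL n x)
  have hi2 : ∀ n, Integrable (fun x => wn n x * (g x * F x)) μ := fun n =>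
    hgF.bdd_mul (hwn n) (Eventually.of_forall fun x => hL n x)
  have ht1 : Tendsto (fun n => ∫ x, wn n x * (g x * (Fn n x - F x)) ∂μ) atTop (𝓝 0) := by
    have hbound : Tendsto (fun n => ENNReal.ofReal L * (eLpNorm g (ENNReal.ofReal q) μ *
        eLpNorm (fun x => Fn n x - F x) (ENNReal.ofReal p) μ)) atTop (𝓝 0) := by
      have := ENNReal.Tendsto.const_mul (a := ENNReal.ofReal L)
        (ENNReal.Tendsto.const_mul (a := eLpNorm g (ENNReal.ofReal q) μ) hlim (Or.inr hg.2.ne))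
        (Or.inr ENNReal.ofReal_ne_top)
      simpa using this
    rw [tendsto_zero_iff_norm_tendsto_zero]
    have hle : ∀ n, ‖∫ x, wn n x * (g x * (Fn n x - F x)) ∂μ‖ₑ ≤
        ENNReal.ofReal L * (eLpNorm g (ENNReal.ofReal q) μ *
        eLpNorm (fun x => Fn n x - F x) (ENNReal.ofReal p) μ) := fun n => by
      refine (enorm_integral_le_lintegral_enorm _).trans ?_
      have h1 : ∫⁻ x, ‖g x * (Fn n x - F x)‖ₑ ∂μ ≤ eLpNorm g (ENNReal.ofReal q) μ *
          eLpNorm (fun x => Fn n x - F x) (ENNReal.ofReal p) μ := by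
        have := eLpNorm_smul_le_mul_eLpNorm (p := ENNReal.ofReal q) (q := ENNReal.ofReal p)
          (r := 1) (hD n).1 hg.1
        rw [eLpNorm_one_eq_lintegral_enorm] at this
        exact this
      refine le_trans ?_ (mul_le_mul_right h1 _)
      rw [← lintegral_const_mul' _ _ ENNReal.ofReal_ne_top]
      refine lintegral_mono fun x => ?_
      rw [enorm_mul]
      refine mul_le_mul_left ?_ _
      rw [← ofReal_norm]
      exact ENNReal.ofReal_le_ofReal (hL n x)
    have := (ENNReal.tendsto_toReal ENNReal.zero_ne_top).comp
      (tendsto_of_tendsto_of_tendsto_of_le_of_le tendsto_const_nhds hbound (fun n => zero_le) hle)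
    simpa [Function.comp_def] using this
  have ht2 : Tendsto (fun n => ∫ x, wn n x * (g x * F x) ∂μ) atTop
      (𝓝 (∫ x, w x * (g x * F x) ∂μ)) := by
    refine tendsto_integral_of_dominated_convergence (fun x => L * ‖g x * F x‖)
      (fun n => (hi2 n).1) (hgF.norm.const_mul L) (fun n => Eventually.of_forall fun x => ?_) ?_
    · rw [norm_mul]
      exact mul_le_mul_of_nonneg_right (hL n x) (norm_nonneg _)
    · filter_upwards [hw] with x hx using hx.mul_const _
  have := ht1.add ht2
  rw [zero_add] at this
  refine (this.congr fun n => ?_).trans_eq ?_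
  · rw [← integral_add (hi1 n) (hi2 n)]
    exact integral_congr_ae (Eventually.of_forall fun x => by simp only; ring)
  · congr 1
    exact integral_congr_ae (Eventually.of_forall fun x => by simp only; ring)

/-! ### The level-set inequality in `W_0^{1,p⃗}` -/

lemma inv_pbar {N : ℕ} (p : Fin N → ℝ) : (pbar p)⁻¹ = ∑ i, 1 / p i * (1 / (N : ℝ)) := by
  rw [pbar, inv_inv, Finset.mul_sum]
  exact Finset.sum_congr rfl fun i _ => mul_comm _ _

lemma sum_one_sub_inv {N : ℕ} (hN : 0 < N) (p : Fin N → ℝ) :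
    ∑ i, (1 - 1 / p i) * (1 / (N : ℝ)) = 1 - (pbar p)⁻¹ := by
  have hN' : (N : ℝ) ≠ 0 := by positivity
  simp only [sub_mul, Finset.sum_sub_distrib, inv_pbar]
  simp [hN']

lemma inv_pbar_pos {N : ℕ} (hN : 0 < N) {p : Fin N → ℝ} (hp : ∀ i, 1 < p i) :
    0 < (pbar p)⁻¹ := by
  have : Nonempty (Fin N) := ⟨⟨0, hN⟩⟩
  rw [inv_pbar]
  refine Finset.sum_pos (fun i _ => ?_) Finset.univ_nonempty
  have := hp i
  positivity

lemma inv_pbar_lt_one {N : ℕ} (hN : 0 < N) {p : Fin N → ℝ} (hp : ∀ i, 1 < p i) :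
    (pbar p)⁻¹ < 1 := by
  have : Nonempty (Fin N) := ⟨⟨0, hN⟩⟩
  rw [← sub_pos, ← sum_one_sub_inv hN]
  refine Finset.sum_pos (fun i _ => ?_) Finset.univ_nonempty
  have h1 := hp i
  have : 1 / p i < 1 := by rw [div_lt_one (by linarith)]; exact h1
  have : 0 < 1 - 1 / p i := by linarith
  positivity

lemma pbar_pos {N : ℕ} (hN : 0 < N) {p : Fin N → ℝ} (hp : ∀ i, 1 < p i) : 0 < pbar p :=
  inv_pos.1 (inv_pbar_pos hN hp)

/-- The distribution function `k ↦ |{x ∈ Ω : k < |u(x)|}|`. -/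
noncomputable def distrib {N : ℕ} (Ω : Set (E N)) (u : E N → ℝ) (k : ℝ) : ℝ :=
  (volume.restrict Ω).real {x | k < |u x|}

lemma distrib_nonneg {N : ℕ} (Ω : Set (E N)) (u : E N → ℝ) (k : ℝ) : 0 ≤ distrib Ω u k :=
  measureReal_nonneg

lemma distrib_le {N : ℕ} (Ω : Set (E N)) [IsFiniteMeasure (volume.restrict Ω)] (u : E N → ℝ)
    (k : ℝ) : distrib Ω u k ≤ (volume.restrict Ω).real Set.univ :=
  measureReal_mono (Set.subset_univ _)

lemma distrib_antitone {N : ℕ} (Ω : Set (E N)) [IsFiniteMeasure (volume.restrict Ω)]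
    (u : E N → ℝ) : Antitone (distrib Ω u) := fun _ _ h =>
  measureReal_mono fun _ hx => lt_of_le_of_lt h hx

section

variable {N : ℕ} {Ω : Set (E N)} {p : Fin N → ℝ} {u : E N → ℝ} {Du : E N → E N}
  {c k h : ℝ} {ψ : ℝ → ℝ}

/-- The anisotropic Gagliardo–Nirenberg inequality for a smooth truncation of `u`. -/
lemma MemW0.lintegral_cutoff_le (hN : 2 ≤ N)
    [IsFiniteMeasure (volume.restrict Ω)] (hp : ∀ i, 1 < p i)
    (hu : MemW0 Ω p u Du) (hψ : IsCutoff c k h ψ) :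
    ∫⁻ x in Ω, ‖ψ (u x)‖ₑ ^ ((N : ℝ) / (N - 1)) ≤
      ENNReal.ofReal ((N * ∏ i, (∫ x in Ω, deriv ψ (u x) * |Du x i|) ^ (1 / (N : ℝ))) ^
        ((N : ℝ) / (N - 1))) := by
  have hN' : (2 : ℝ) ≤ N := by exact_mod_cast hN
  have hq : 0 ≤ (N : ℝ) / (N - 1) := div_nonneg (by linarith) (by linarith)
  obtain ⟨φ, hφ, hae, hgrad⟩ := hu.exists_approx
  have hcont := hψ.smooth.continuous
  have hlimi : ∀ i, Tendsto (fun n => ∫ x, |partialDeriv i (ψ ∘ φ n) x|) atTop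
      (𝓝 (∫ x in Ω, deriv ψ (u x) * |Du x i|)) := fun i => by
    have hconj : (p i).HolderConjugate (p i).conjExponent :=
      Real.HolderConjugate.conjExponent (hp i)
    have key := tendsto_integral_mul_mul (μ := volume.restrict Ω) (g := fun _ => 1)
      (F := fun x => |Du x i|) (w := fun x => deriv ψ (u x))
      (Fn := fun n x => |partialDeriv i (φ n) x|) (wn := fun n x => deriv ψ (φ n x)) (L := c)
      hconj (memLp_const 1) (hu.memLp_grad i).abs
      (fun n => ((hφ n).memLp_partialDeriv i _).abs)
      (tendsto_of_tendsto_of_tendsto_of_le_of_le tendsto_const_nhds (hgrad i)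
        (fun n => zero_le)
        fun n => eLpNorm_mono fun x => by
          simpa using abs_abs_sub_abs_le_abs_sub (partialDeriv i (φ n) x) (Du x i))
      (fun n => (hψ.continuous_deriv.comp (hφ n).smooth.continuous).aestronglyMeasurable)
      (fun n x => hψ.abs_deriv_le _)
      (by filter_upwards [hae] with x hx using (hψ.continuous_deriv.tendsto _).comp hx)
    simp only [one_mul] at key
    refine key.congr fun n => ?_
    have hz : ∀ x, x ∉ Ω → |partialDeriv i (ψ ∘ φ n) x| = 0 := fun x hx => by
      by_contra hne
      exact hx (((hφ n).comp hψ.smooth hψ.zero).support_partialDeriv_subset i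
        fun h0 => hne (by rw [h0, abs_zero]))
    rw [← setIntegral_eq_integral_of_forall_compl_eq_zero hz]
    refine integral_congr_ae (Eventually.of_forall fun x => ?_)
    simp only
    rw [(hφ n).partialDeriv_comp hψ.smooth, abs_mul, abs_of_nonneg (hψ.deriv_nonneg _)]
  have hlim : Tendsto (fun n => ENNReal.ofReal
      ((N * ∏ i, (∫ x, |partialDeriv i (ψ ∘ φ n) x|) ^ (1 / (N : ℝ))) ^ ((N : ℝ) / (N - 1))))
      atTop (𝓝 (ENNReal.ofReal ((N * ∏ i, (∫ x in Ω, deriv ψ (u x) * |Du x i|) ^ (1 / (N : ℝ))) ^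
        ((N : ℝ) / (N - 1))))) :=
    ENNReal.tendsto_ofReal (Tendsto.rpow_const (Tendsto.const_mul _
      (tendsto_finsetProd _ fun i _ => (hlimi i).rpow_const (Or.inr (by positivity)))) (Or.inr hq))
  calc ∫⁻ x in Ω, ‖ψ (u x)‖ₑ ^ ((N : ℝ) / (N - 1))
      = ∫⁻ x in Ω, liminf (fun n => ‖ψ (φ n x)‖ₑ ^ ((N : ℝ) / (N - 1))) atTop := by
        refine lintegral_congr_ae ?_
        filter_upwards [hae] with x hx
        refine (Tendsto.liminf_eq ?_).symm
        exact (((hcont.tendsto _).comp hx).enorm).ennrpow_const _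
    _ ≤ liminf (fun n => ∫⁻ x in Ω, ‖ψ (φ n x)‖ₑ ^ ((N : ℝ) / (N - 1))) atTop :=
        lintegral_liminf_le fun n => by
          have := (hcont.comp (hφ n).smooth.continuous).measurable
          exact this.enorm.pow_const _
    _ ≤ liminf (fun n => ENNReal.ofReal
          ((N * ∏ i, (∫ x, |partialDeriv i (ψ ∘ φ n) x|) ^ (1 / (N : ℝ))) ^
            ((N : ℝ) / (N - 1)))) atTop := by
        refine liminf_le_liminf (Eventually.of_forall fun n => ?_)
        have ht := (hφ n).comp hψ.smooth hψ.zero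
        exact (setLIntegral_le_lintegral _ _).trans
          (lintegral_rpow_le_prod_integral_partialDeriv hN ht.contDiff_one ht.compact_support)
    _ = _ := hlim.liminf_eq

lemma MemW0.aemeasurable (hu : MemW0 Ω p u Du) : AEMeasurable u (volume.restrict Ω) :=
  hu.memLp_one.1.aemeasurable

lemma MemW0.distrib_rpow_le (hN : 2 ≤ N)
    [IsFiniteMeasure (volume.restrict Ω)] (hp : ∀ i, 1 < p i)
    (hu : MemW0 Ω p u Du) (hkh : k < h) (hψ : IsCutoff c k h ψ) :
    (h - k) * distrib Ω u h ^ (1 - 1 / (N : ℝ)) ≤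
      N * ∏ i, (∫ x in Ω, deriv ψ (u x) * |Du x i|) ^ (1 / (N : ℝ)) := by
  have hN' : (2 : ℝ) ≤ N := by exact_mod_cast hN
  have hd : 0 < h - k := sub_pos.2 hkh
  have hq : 0 < (N : ℝ) / (N - 1) := div_pos (by linarith) (by linarith)
  set q : ℝ := (N : ℝ) / (N - 1) with hqdef
  have hR : 0 ≤ N * ∏ i, (∫ x in Ω, deriv ψ (u x) * |Du x i|) ^ (1 / (N : ℝ)) :=
    mul_nonneg (by positivity) (Finset.prod_nonneg fun i _ => Real.rpow_nonneg
      (integral_nonneg fun x => mul_nonneg (hψ.deriv_nonneg _) (abs_nonneg _)) _)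
  have h1 := hu.lintegral_cutoff_le hN hp hψ
  have hm : AEMeasurable (fun x => ‖ψ (u x)‖ₑ ^ q) (volume.restrict Ω) :=
    (hψ.smooth.continuous.measurable.comp_aemeasurable hu.aemeasurable).enorm.pow_const _
  have h2 : ENNReal.ofReal ((h - k) ^ q) * (volume.restrict Ω) {x | h < |u x|} ≤
      ∫⁻ x in Ω, ‖ψ (u x)‖ₑ ^ q := by
    refine le_trans ?_ (mul_meas_ge_le_lintegral₀ hm (ENNReal.ofReal ((h - k) ^ q)))
    refine mul_le_mul_right (measure_mono fun x hx => ?_) _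
    have hx' : h < |u x| := hx
    change _ ≤ ‖ψ (u x)‖ₑ ^ q
    rw [← ofReal_norm, Real.norm_eq_abs, hψ.abs_eq _ hx'.le,
      ENNReal.ofReal_rpow_of_nonneg hd.le hq.le]
  have h3 := h2.trans h1
  have h4 : (h - k) ^ q * distrib Ω u h ≤
      (N * ∏ i, (∫ x in Ω, deriv ψ (u x) * |Du x i|) ^ (1 / (N : ℝ))) ^ q := by
    have := ENNReal.toReal_mono ENNReal.ofReal_ne_top h3
    rw [ENNReal.toReal_mul, ENNReal.toReal_ofReal (by positivity),
      ENNReal.toReal_ofReal (by positivity)] at this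
    exact this
  have hqi : 1 - 1 / (N : ℝ) = 1 / q := by
    rw [hqdef]; field_simp
  rw [← Real.rpow_le_rpow_iff (mul_nonneg hd.le (Real.rpow_nonneg (distrib_nonneg _ _ _) _)) hR hq,
    Real.mul_rpow hd.le (Real.rpow_nonneg (distrib_nonneg _ _ _) _),
    ← Real.rpow_mul (distrib_nonneg _ _ _), hqi, one_div, inv_mul_cancel₀ hq.ne', Real.rpow_one]
  exact h4

lemma integrable_deriv_cutoff_mul (hu : AEMeasurable u (volume.restrict Ω))
    (hψ : IsCutoff c k h ψ) {g : E N → ℝ} (hg : Integrable g (volume.restrict Ω)) :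
    Integrable (fun x => deriv ψ (u x) * g x) (volume.restrict Ω) :=
  hg.bdd_mul (hψ.continuous_deriv.measurable.comp_aemeasurable hu).aestronglyMeasurable
    (Eventually.of_forall fun x => hψ.abs_deriv_le (u x))

lemma integral_deriv_cutoff_le [IsFiniteMeasure (volume.restrict Ω)]
    (hu : AEMeasurable u (volume.restrict Ω)) (hψ : IsCutoff c k h ψ) :
    ∫ x in Ω, deriv ψ (u x) ≤ c * distrib Ω u k := by
  have hs : NullMeasurableSet {x | k < |u x|} (volume.restrict Ω) :=
    nullMeasurableSet_lt aemeasurable_const hu.abs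
  have hi : Integrable ({x | k < |u x|}.indicator fun _ => c) (volume.restrict Ω) :=
    (integrable_const c).indicator₀ hs
  have hi' := integrable_deriv_cutoff_mul hu hψ (integrable_const 1)
  simp only [mul_one] at hi'
  calc ∫ x in Ω, deriv ψ (u x) ≤ ∫ x in Ω, {x | k < |u x|}.indicator (fun _ => c) x := by
        refine integral_mono hi' hi fun x => ?_
        by_cases hx : x ∈ {x | k < |u x|}
        · rw [Set.indicator_of_mem hx]; exact hψ.deriv_le _
        · rw [Set.indicator_of_notMem hx]
          by_contra hne
          exact hx (hψ.deriv_ne _ fun h0 => hne h0.le).1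
    _ = c * distrib Ω u k := by
        rw [integral_indicator₀ hs, setIntegral_const, smul_eq_mul, mul_comm]
        rfl

lemma integral_deriv_cutoff_mul_abs_le [IsFiniteMeasure (volume.restrict Ω)] {r : ℝ} (hr : 1 < r)
    (hu : AEMeasurable u (volume.restrict Ω)) (hψ : IsCutoff c k h ψ) {D : E N → ℝ}
    (hD : MemLp D (ENNReal.ofReal r) (volume.restrict Ω)) {e : ℝ}
    (he : ∫ x in Ω, deriv ψ (u x) * |D x| ^ r ≤ e) :
    ∫ x in Ω, deriv ψ (u x) * |D x| ≤ e ^ (1 / r) * (c * distrib Ω u k) ^ (1 - 1 / r) := by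
  have hr0 : 0 < r := by linarith
  have hconj : r.HolderConjugate r.conjExponent := Real.HolderConjugate.conjExponent hr
  set q := r.conjExponent
  have hq0 : 0 < q := hconj.symm.pos
  have hwm : AEMeasurable (fun x => deriv ψ (u x)) (volume.restrict Ω) :=
    hψ.continuous_deriv.measurable.comp_aemeasurable hu
  have hw0 : ∀ x, 0 ≤ deriv ψ (u x) := fun x => hψ.deriv_nonneg _
  have hb : ∀ {s : ℝ}, 0 ≤ s → ∀ᵐ x ∂(volume.restrict Ω), ‖deriv ψ (u x) ^ s‖ ≤ c ^ s :=
    fun {s} hs => Eventually.of_forall fun x => by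
      rw [Real.norm_eq_abs, abs_of_nonneg (Real.rpow_nonneg (hw0 x) _)]
      exact Real.rpow_le_rpow (hw0 x) (hψ.deriv_le _) hs
  have hf : MemLp (fun x => deriv ψ (u x) ^ (1 / r) * |D x|) (ENNReal.ofReal r)
      (volume.restrict Ω) := by
    refine MemLp.of_le_mul (c := c ^ (1 / r)) hD
      ((hwm.pow_const _).mul hD.1.aemeasurable.abs).aestronglyMeasurable ?_
    filter_upwards [hb (s := 1 / r) (by positivity)] with x hx
    rw [norm_mul, Real.norm_eq_abs |D x|, abs_abs, ← Real.norm_eq_abs]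
    exact mul_le_mul_of_nonneg_right hx (norm_nonneg _)
  have hg : MemLp (fun x => deriv ψ (u x) ^ (1 / q)) (ENNReal.ofReal q) (volume.restrict Ω) :=
    MemLp.of_bound (hwm.pow_const _).aestronglyMeasurable (c ^ (1 / q)) (hb (by positivity))
  have key := integral_mul_le_Lp_mul_Lq_of_nonneg hconj
    (Eventually.of_forall fun x => mul_nonneg (Real.rpow_nonneg (hw0 x) _) (abs_nonneg _))
    (Eventually.of_forall fun x => Real.rpow_nonneg (hw0 x) _) hf hg
  have e1 : ∀ x, deriv ψ (u x) ^ (1 / r) * |D x| * deriv ψ (u x) ^ (1 / q) =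
      deriv ψ (u x) * |D x| := fun x => by
    rw [mul_right_comm, ← Real.rpow_add_of_nonneg (hw0 x) (by positivity) (by positivity), one_div,
      one_div, hconj.inv_add_inv_eq_one, Real.rpow_one]
  have e2 : ∀ x, (deriv ψ (u x) ^ (1 / r) * |D x|) ^ r = deriv ψ (u x) * |D x| ^ r := fun x => by
    rw [Real.mul_rpow (Real.rpow_nonneg (hw0 x) _) (abs_nonneg _), ← Real.rpow_mul (hw0 x), one_div,
      inv_mul_cancel₀ hr0.ne', Real.rpow_one]
  have e3 : ∀ x, (deriv ψ (u x) ^ (1 / q)) ^ q = deriv ψ (u x) := fun x => by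
    rw [← Real.rpow_mul (hw0 x), one_div, inv_mul_cancel₀ hq0.ne', Real.rpow_one]
  simp only [e1, e2, e3] at key
  have hq1 : 1 / q = 1 - 1 / r := by
    have := hconj.inv_add_inv_eq_one
    rw [one_div, one_div]; linarith
  rw [hq1] at key
  refine key.trans (mul_le_mul ?_ ?_ ?_ ?_)
  · exact Real.rpow_le_rpow (integral_nonneg fun x => mul_nonneg (hw0 x)
      (Real.rpow_nonneg (abs_nonneg _) _)) he (by positivity)
  · rw [← hq1]
    exact Real.rpow_le_rpow (integral_nonneg hw0) (integral_deriv_cutoff_le hu hψ) (by positivity)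
  · exact Real.rpow_nonneg (integral_nonneg hw0) _
  · exact Real.rpow_nonneg ((integral_nonneg fun x => mul_nonneg (hw0 x)
      (Real.rpow_nonneg (abs_nonneg _) _)).trans he) _

/-- The energy of `u` between the levels `k` and `h` controls the measure of the level set at `h`
in terms of that at `k`. The exponents of the single directions combine into `p̄`. -/
theorem MemW0.distrib_le_of_energy_le (hN : 2 ≤ N)
    [IsFiniteMeasure (volume.restrict Ω)] (hp : ∀ i, 1 < p i)
    (hu : MemW0 Ω p u Du) (hkh : k < h) (hψ : IsCutoff c k h ψ) (hc : 0 ≤ c) {e : ℝ}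
    (he : ∀ i, ∫ x in Ω, deriv ψ (u x) * |Du x i| ^ p i ≤ e) :
    (h - k) * distrib Ω u h ^ (1 - 1 / (N : ℝ)) ≤
      N * (e ^ (pbar p)⁻¹ * (c * distrib Ω u k) ^ (1 - (pbar p)⁻¹)) := by
  have hN0 : 0 < N := by omega
  have he0 : 0 ≤ e := (integral_nonneg fun x => mul_nonneg (hψ.deriv_nonneg _)
    (Real.rpow_nonneg (abs_nonneg _) _)).trans (he ⟨0, hN0⟩)
  have ha : 0 ≤ c * distrib Ω u k := mul_nonneg hc (distrib_nonneg _ _ _)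
  have hpi : ∀ i, 0 ≤ 1 - 1 / p i := fun i => by
    have := hp i
    rw [sub_nonneg, div_le_one (by linarith)]; linarith
  have hpi' : ∀ i, 0 ≤ 1 / p i := fun i => by have := hp i; positivity
  refine (hu.distrib_rpow_le hN hp hkh hψ).trans
    (mul_le_mul_of_nonneg_left ?_ (by positivity))
  calc ∏ i, (∫ x in Ω, deriv ψ (u x) * |Du x i|) ^ (1 / (N : ℝ))
      ≤ ∏ i, (e ^ (1 / p i * (1 / (N : ℝ))) *
          (c * distrib Ω u k) ^ ((1 - 1 / p i) * (1 / (N : ℝ)))) := by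
        refine Finset.prod_le_prod (fun i _ => Real.rpow_nonneg (integral_nonneg fun x =>
          mul_nonneg (hψ.deriv_nonneg _) (abs_nonneg _)) _) fun i _ => ?_
        rw [Real.rpow_mul he0, Real.rpow_mul ha,
          ← Real.mul_rpow (Real.rpow_nonneg he0 _) (Real.rpow_nonneg ha _)]
        exact Real.rpow_le_rpow (integral_nonneg fun x => mul_nonneg (hψ.deriv_nonneg _)
          (abs_nonneg _)) (integral_deriv_cutoff_mul_abs_le (hp i) hu.aemeasurable hψ
            (hu.memLp_grad i) (he i)) (by positivity)
    _ = e ^ (pbar p)⁻¹ * (c * distrib Ω u k) ^ (1 - (pbar p)⁻¹) := by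
        rw [Finset.prod_mul_distrib, ← Real.rpow_sum_of_nonneg he0, ← Real.rpow_sum_of_nonneg ha,
          sum_one_sub_inv hN0, inv_pbar]
        · exact fun i _ => mul_nonneg (hpi i) (by positivity)
        · exact fun i _ => mul_nonneg (hpi' i) (by positivity)

end

/-! ### Integrability of powers of functions in `W_0^{1,p⃗}` -/

/-- A level-set inequality with a larger power on the left forces polynomial decay along the
dyadic levels. -/
lemma exists_le_two_pow_of_mul_rpow_le {a : ℝ → ℝ} (ha : ∀ k, 0 ≤ a k) {θ τ D : ℝ} (hτ : 0 ≤ τ)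
    (hτθ : τ < θ) (hD : 0 ≤ D) (h : ∀ k, 1 ≤ k → k * a (2 * k) ^ θ ≤ D * a k ^ τ) :
    ∃ M, 0 ≤ M ∧ ∀ j : ℕ, a (2 ^ j) ≤ M * ((2 : ℝ) ^ (-(1 / (θ - τ)))) ^ j := by
  set d := θ - τ with hd
  have hd0 : 0 < d := sub_pos.2 hτθ
  have hθ : 0 < θ := hτ.trans_lt hτθ
  set q := 1 / d with hq
  have hq0 : 0 < q := by positivity
  set r : ℝ := (2 : ℝ) ^ (-q) with hr
  have hr0 : 0 < r := by positivity
  -- With `q = 1 / (θ - τ)` both sides of the recursion scale alike in `j`, so that one constant `M`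
  -- serves all steps.
  set M : ℝ := max (a 1) ((D * 2 ^ (q * θ)) ^ q) with hM
  have hM0 : 0 ≤ M := (ha 1).trans (le_max_left _ _)
  have hM1 : D * 2 ^ (q * θ) ≤ M ^ d := by
    calc D * 2 ^ (q * θ) = ((D * 2 ^ (q * θ)) ^ q) ^ d := by
          rw [← Real.rpow_mul (by positivity), hq, one_div, inv_mul_cancel₀ hd0.ne', Real.rpow_one]
      _ ≤ M ^ d := Real.rpow_le_rpow (by positivity) (le_max_right _ _) hd0.le
  have hrd : r ^ d = 1 / 2 := by
    rw [hr, ← Real.rpow_mul (by norm_num), hq]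
    have : -(1 / d) * d = -1 := by field_simp
    rw [this, Real.rpow_neg_one]; norm_num
  have hrθ : r ^ θ * 2 ^ (q * θ) = 1 := by
    rw [hr, ← Real.rpow_mul (by norm_num), ← Real.rpow_add (by norm_num)]
    simp
  refine ⟨M, hM0, fun j => ?_⟩
  induction j with
  | zero =>
    have : a 1 ≤ M := le_max_left _ _
    simpa using this
  | succ j ih =>
    have h2 : (1 : ℝ) ≤ 2 ^ j := one_le_pow₀ (by norm_num)
    have hB : 0 ≤ M * r ^ j := by positivity
    rw [← Real.rpow_le_rpow_iff (ha _) (by positivity) hθ]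
    have h1 := h (2 ^ j) h2
    rw [← pow_succ'] at h1
    have h3 : (2 : ℝ) ^ j * a (2 ^ (j + 1)) ^ θ ≤ D * (M * r ^ j) ^ τ :=
      h1.trans (mul_le_mul_of_nonneg_left (Real.rpow_le_rpow (ha _) ih hτ) hD)
    have h4 : D * (M * r ^ j) ^ τ ≤ 2 ^ j * (M * r ^ (j + 1)) ^ θ := by
      have e1 : (M * r ^ (j + 1)) ^ θ = r ^ θ * ((M * r ^ j) ^ d * (M * r ^ j) ^ τ) := by
        rw [← Real.rpow_add_of_nonneg hB hd0.le hτ, hd, sub_add_cancel, ← Real.mul_rpow hr0.le hB]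
        congr 1; ring
      have e2 : (M * r ^ j) ^ d = M ^ d * (1 / 2) ^ j := by
        rw [Real.mul_rpow hM0 (by positivity), ← Real.rpow_natCast, ← Real.rpow_mul hr0.le,
          mul_comm (j : ℝ) d, Real.rpow_mul hr0.le, hrd, Real.rpow_natCast]
      have e3 : (2 : ℝ) ^ j * (1 / 2) ^ j = 1 := by rw [← mul_pow]; norm_num
      calc D * (M * r ^ j) ^ τ = r ^ θ * (D * 2 ^ (q * θ)) * (M * r ^ j) ^ τ := by
            linear_combination (-(D * (M * r ^ j) ^ τ)) * hrθ
        _ ≤ r ^ θ * M ^ d * (M * r ^ j) ^ τ := by gcongr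
        _ = 2 ^ j * (M * r ^ (j + 1)) ^ θ := by
            rw [e1, e2]
            linear_combination (-(r ^ θ * M ^ d * (M * r ^ j) ^ τ)) * e3
    exact le_of_mul_le_mul_left (h3.trans h4) (by positivity)

lemma integrable_rpow_of_measure_le {X : Type*} [MeasurableSpace X] {μ : Measure X}
    [IsFiniteMeasure μ] {u : X → ℝ} (hu : AEMeasurable u μ) {M q r : ℝ}
    (h : ∀ j : ℕ, μ.real {x | 2 ^ j < |u x|} ≤ M * ((2 : ℝ) ^ (-q)) ^ j) (hr : 0 ≤ r)
    (hrq : r < q) : Integrable (fun x => |u x| ^ r) μ := by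
  have hm : AEMeasurable (fun x => |u x| ^ r) μ := hu.abs.pow_const _
  refine ⟨hm.aestronglyMeasurable, ?_⟩
  have hs : ∀ j : ℕ, NullMeasurableSet {x | 2 ^ j < |u x|} μ := fun j =>
    nullMeasurableSet_lt aemeasurable_const hu.abs
  have hpt : ∀ x, ‖|u x| ^ r‖ₑ ≤ 1 + ∑' j : ℕ,
      {x | 2 ^ j < |u x|}.indicator (fun _ => ENNReal.ofReal ((2 ^ (j + 1)) ^ r)) x := fun x => by
    rw [Real.enorm_of_nonneg (by positivity)]
    rcases le_or_gt (|u x|) 1 with hx | hx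
    · refine le_trans ?_ le_self_add
      rw [← ENNReal.ofReal_one]
      exact ENNReal.ofReal_le_ofReal (Real.rpow_le_one (abs_nonneg _) hx hr)
    · have hex : ∃ n : ℕ, |u x| ≤ 2 ^ n := (pow_unbounded_of_one_lt _ one_lt_two).imp fun _ => le_of_lt
      classical
      obtain ⟨j, hj⟩ : ∃ j, Nat.find hex = j + 1 := Nat.exists_eq_succ_of_ne_zero fun h0 => by
        have := Nat.find_spec hex
        rw [h0, pow_zero] at this
        linarith
      have h1 : 2 ^ j < |u x| := not_le.1 (Nat.find_min hex (by omega))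
      have h2 : |u x| ≤ 2 ^ (j + 1) := hj ▸ Nat.find_spec hex
      refine le_trans ?_ ((ENNReal.le_tsum j).trans le_add_self)
      rw [Set.indicator_of_mem (show x ∈ {x | 2 ^ j < |u x|} from h1)]
      exact ENNReal.ofReal_le_ofReal (Real.rpow_le_rpow (abs_nonneg _) h2 hr)
  have hsum : Summable fun j : ℕ => 2 ^ r * M * ((2 : ℝ) ^ (r - q)) ^ j :=
    (summable_geometric_of_lt_one (by positivity)
      (Real.rpow_lt_one_of_one_lt_of_neg one_lt_two (by linarith))).mul_left _
  have hterm : ∀ j : ℕ, ENNReal.ofReal ((2 ^ (j + 1)) ^ r) * μ {x | 2 ^ j < |u x|} ≤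
      ENNReal.ofReal (2 ^ r * M * ((2 : ℝ) ^ (r - q)) ^ j) := fun j => by
    rw [← ofReal_measureReal (measure_ne_top μ _), ← ENNReal.ofReal_mul (by positivity)]
    refine ENNReal.ofReal_le_ofReal ?_
    calc ((2 : ℝ) ^ (j + 1)) ^ r * μ.real {x | 2 ^ j < |u x|}
        ≤ ((2 : ℝ) ^ (j + 1)) ^ r * (M * ((2 : ℝ) ^ (-q)) ^ j) :=
          mul_le_mul_of_nonneg_left (h j) (by positivity)
      _ = _ := by
          rw [pow_succ, Real.mul_rpow (by positivity) (by norm_num), ← Real.rpow_natCast 2 j,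
            ← Real.rpow_mul (by norm_num), mul_comm (j : ℝ) r, Real.rpow_mul (by norm_num),
            Real.rpow_natCast, sub_eq_add_neg, Real.rpow_add (by norm_num), mul_pow]
          ring
  calc ∫⁻ x, ‖|u x| ^ r‖ₑ ∂μ ≤ ∫⁻ x, (1 + ∑' j : ℕ,
        {x | 2 ^ j < |u x|}.indicator (fun _ => ENNReal.ofReal ((2 ^ (j + 1)) ^ r)) x) ∂μ :=
        lintegral_mono hpt
    _ = μ Set.univ + ∑' j : ℕ, ENNReal.ofReal ((2 ^ (j + 1)) ^ r) * μ {x | 2 ^ j < |u x|} := by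
        rw [lintegral_add_left measurable_const, lintegral_one,
          lintegral_tsum fun j => (aemeasurable_const.indicator₀ (hs j))]
        congr 2
        ext j
        rw [lintegral_indicator₀ (hs j), setLIntegral_const]
    _ ≤ μ Set.univ + ∑' j : ℕ, ENNReal.ofReal (2 ^ r * M * ((2 : ℝ) ^ (r - q)) ^ j) := by
        gcongr with j; exact hterm j
    _ < ⊤ := ENNReal.add_lt_top.2 ⟨measure_lt_top _ _, hsum.tsum_ofReal_ne_top.lt_top⟩

/-- A scaled Young inequality. -/
lemma exists_mul_le_rpow_add {p q : ℝ} (hpq : p.HolderConjugate q) {ε : ℝ} (hε : 0 < ε) :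
    ∃ C, 0 ≤ C ∧ ∀ x y : ℝ, 0 ≤ x → 0 ≤ y → x * y ≤ ε * x ^ p + C * y ^ q := by
  set δ : ℝ := ε ^ (1 / p) with hδ
  have hp := hpq.pos
  have hq := hpq.symm.pos
  have hδ0 : 0 < δ := by positivity
  have hδp : δ ^ p = ε := by
    rw [hδ, ← Real.rpow_mul hε.le, one_div, inv_mul_cancel₀ hp.ne', Real.rpow_one]
  refine ⟨δ⁻¹ ^ q, by positivity, fun x y hx hy => ?_⟩
  have h1 := Real.young_inequality_of_nonneg (mul_nonneg hδ0.le hx)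
    (mul_nonneg (inv_nonneg.2 hδ0.le) hy) hpq
  rw [Real.mul_rpow hδ0.le hx, Real.mul_rpow (inv_nonneg.2 hδ0.le) hy, hδp] at h1
  have h2 : δ * x * (δ⁻¹ * y) = x * y := by field_simp
  rw [h2] at h1
  have h3 : ε * x ^ p / p ≤ ε * x ^ p := div_le_self (by positivity) hpq.lt.le
  have h4 : δ⁻¹ ^ q * y ^ q / q ≤ δ⁻¹ ^ q * y ^ q := div_le_self (by positivity) hpq.symm.lt.le
  linarith

lemma integral_rpow_le_of_isTest {N : ℕ} {Ω : Set (E N)} (hΩ : Bornology.IsBounded Ω) {r : ℝ}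
    (hr : 1 < r) (i : Fin N) :
    ∃ C, 0 ≤ C ∧ ∀ φ, IsTest Ω φ → ∫ x, |φ x| ^ r ≤ C * ∫ x, |partialDeriv i φ x| ^ r := by
  obtain ⟨R, hR⟩ := hΩ.exists_norm_le
  have hconj : r.HolderConjugate r.conjExponent := Real.HolderConjugate.conjExponent hr
  obtain ⟨C, hC0, hC⟩ := exists_mul_le_rpow_add hconj.symm (ε := 1 / 2) (by norm_num)
  set R' := max R 0
  refine ⟨2 * (C * (r * R') ^ r), by positivity, fun φ hφ => ?_⟩
  have hr0 : 0 < r := by linarith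
  have hφc := hφ.smooth.continuous
  have hdc := hφ.continuous_partialDeriv i
  have hfd : ∀ x, HasFDerivAt (fun x => |φ x| ^ r)
      ((r * |φ x| ^ (r - 2) * φ x) • fderiv ℝ φ x) x := fun x => by
    have := (hasDerivAt_abs_rpow (φ x) hr).comp_hasFDerivAt x
      (hφ.smooth.differentiable (by simp) x).hasFDerivAt
    exact this
  have hfC : ContDiff ℝ 1 (fun x => |φ x| ^ r) :=
    (contDiff_norm_rpow (E := ℝ) hr).comp hφ.contDiff_one
  have hfs : HasCompactSupport (fun x => |φ x| ^ r) :=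
    hφ.compact_support.comp_left (g := fun t => |t| ^ r) (by simp [hr0.ne'])
  have hds : HasCompactSupport (fun x => |partialDeriv i φ x| ^ r) :=
    (hasCompactSupport_partialDeriv hφ.compact_support i).comp_left (g := fun t => |t| ^ r)
      (by simp [hr0.ne'])
  have hfi : Integrable (fun x => |φ x| ^ r) := hfC.continuous.integrable_of_hasCompactSupport hfs
  have hdi : Integrable (fun x => |partialDeriv i φ x| ^ r) :=
    (hdc.abs.rpow_const fun _ => Or.inr hr0.le).integrable_of_hasCompactSupport hds
  -- Integrate `|φ|^r = |φ|^r ∂_i x_i` by parts; `x_i` is bounded on `Ω`.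
  let l : E N →L[ℝ] ℝ := EuclideanSpace.proj i
  have hl : ∀ x, fderiv ℝ l x (EuclideanSpace.single i 1) = 1 := fun x => by
    rw [l.fderiv]; simp [l]
  have hprod : Integrable (fun x => fderiv ℝ (fun x => |φ x| ^ r) x (EuclideanSpace.single i 1) * l x) :=
    ((continuous_partialDeriv hfC i).mul l.continuous).integrable_of_hasCompactSupport
      ((hasCompactSupport_partialDeriv hfs i).mul_right)
  have hibp := integral_mul_fderiv_eq_neg_fderiv_mul_of_integrable (μ := volume)
    (f := fun x => |φ x| ^ r) (g := l) (v := EuclideanSpace.single i 1) hprod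
    (by simpa only [hl, mul_one] using hfi)
    ((hfC.continuous.mul l.continuous).integrable_of_hasCompactSupport hfs.mul_right)
    (fun x _ => hfC.differentiable one_ne_zero x) (fun x _ => l.differentiableAt)
  simp only [hl, mul_one] at hibp
  have hpt : ∀ x, -(fderiv ℝ (fun x => |φ x| ^ r) x (EuclideanSpace.single i 1) * l x) ≤
      1 / 2 * |φ x| ^ r + C * (r * R') ^ r * |partialDeriv i φ x| ^ r := fun x => by
    by_cases hx : x ∈ Ω
    · have h1 : |l x| ≤ R' := by
        refine le_trans ?_ ((hR x hx).trans (le_max_left _ _))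
        simpa [l] using PiLp.norm_apply_le x i
      have h2 : |fderiv ℝ (fun x => |φ x| ^ r) x (EuclideanSpace.single i 1)| =
          r * |φ x| ^ (r - 1) * |partialDeriv i φ x| := by
        rw [(hfd x).fderiv]
        simp only [smul_apply, smul_eq_mul, abs_mul, abs_of_pos hr0,
          abs_of_nonneg (Real.rpow_nonneg (abs_nonneg (φ x)) _), partialDeriv]
        rcases eq_or_ne (φ x) 0 with h0 | h0
        · rw [h0, abs_zero, Real.zero_rpow (by linarith : r - 1 ≠ 0)]; simp
        · have : |φ x| ^ (r - 1) = |φ x| ^ (r - 2) * |φ x| := by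
            rw [← Real.rpow_add_one (abs_ne_zero.2 h0)]; congr 1; ring
          rw [this]; ring
      have h3 := hC (|φ x| ^ (r - 1)) (r * R' * |partialDeriv i φ x|) (by positivity)
        (by positivity)
      have h4 : (|φ x| ^ (r - 1)) ^ r.conjExponent = |φ x| ^ r := by
        rw [← Real.rpow_mul (abs_nonneg _), Real.conjExponent]
        congr 1
        have : r - 1 ≠ 0 := by linarith
        field_simp
      rw [h4, Real.mul_rpow (by positivity) (abs_nonneg _), ← mul_assoc C] at h3
      refine le_trans ?_ h3
      calc _ ≤ |fderiv ℝ (fun x => |φ x| ^ r) x (EuclideanSpace.single i 1)| * |l x| := by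
            rw [← abs_mul]; exact neg_le_abs _
        _ ≤ r * |φ x| ^ (r - 1) * |partialDeriv i φ x| * R' := by
            rw [h2]; exact mul_le_mul_of_nonneg_left h1 (by positivity)
        _ = _ := by ring
    · have h0 : φ x = 0 := by
        by_contra hne
        exact hx (hφ.support_subset (subset_tsupport _ hne))
      rw [(hfd x).fderiv, h0]
      simp only [mul_zero, zero_smul, zero_apply, zero_mul, neg_zero]
      positivity
  have := integral_mono hprod.neg ((hfi.const_mul (1 / 2)).add (hdi.const_mul (C * (r * R') ^ r)))
    hpt
  simp only [Pi.neg_apply, Pi.add_apply] at this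
  rw [integral_neg, ← hibp, integral_add (hfi.const_mul _) (hdi.const_mul _), integral_const_mul,
    integral_const_mul] at this
  linarith

section

variable {N : ℕ} {Ω : Set (E N)} {p : Fin N → ℝ} {u : E N → ℝ} {Du : E N → E N}

lemma integrable_abs_rpow {X : Type*} [MeasurableSpace X] {μ : Measure X} {r : ℝ} (hr : 0 < r)
    {f : X → ℝ} (hf : MemLp f (ENNReal.ofReal r) μ) : Integrable (fun x => |f x| ^ r) μ := by
  have := hf.integrable_norm_rpow (by simpa using hr) ENNReal.ofReal_ne_top
  simpa [ENNReal.toReal_ofReal hr.le] using this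

/-- The weak-type form of the anisotropic Sobolev embedding: `u ∈ L^r(Ω)` for all `r < p̄*`. -/
theorem MemW0.integrable_rpow_of_lt_pstar (hN : 2 ≤ N) [IsFiniteMeasure (volume.restrict Ω)]
    (hp : ∀ i, 1 < p i) (hpN : pbar p < N) (hu : MemW0 Ω p u Du) {r : ℝ} (hr : 0 ≤ r)
    (hrp : r < pstar p) : Integrable (fun x => |u x| ^ r) (volume.restrict Ω) := by
  have hN0 : 0 < N := by omega
  have hNR : (0 : ℝ) < N := by exact_mod_cast hN0
  obtain ⟨c, hc, hex⟩ := exists_isCutoff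
  set e : ℝ := c * ∑ i, ∫ x in Ω, |Du x i| ^ p i with he
  have hint : ∀ i, Integrable (fun x => |Du x i| ^ p i) (volume.restrict Ω) := fun i =>
    integrable_abs_rpow (by linarith [hp i]) (hu.memLp_grad i)
  have hnn : ∀ i, 0 ≤ ∫ x in Ω, |Du x i| ^ p i := fun i =>
    integral_nonneg fun x => Real.rpow_nonneg (abs_nonneg _) _
  have he0 : 0 ≤ e := mul_nonneg hc.le (Finset.sum_nonneg fun i _ => hnn i)
  have hσ : (N : ℝ)⁻¹ < (pbar p)⁻¹ := inv_strictAnti₀ (pbar_pos hN0 hp) hpN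
  have hτ := (inv_pbar_lt_one hN0 hp).le
  have hstep : ∀ k, 1 ≤ k → k * distrib Ω u (2 * k) ^ (1 - 1 / (N : ℝ)) ≤
      (N * (e ^ (pbar p)⁻¹ * c ^ (1 - (pbar p)⁻¹))) * distrib Ω u k ^ (1 - (pbar p)⁻¹) := by
    intro k hk
    obtain ⟨ψ, hψ⟩ := hex k (2 * k) (by linarith) (by linarith)
    have := hu.distrib_le_of_energy_le hN hp (by linarith) hψ hc.le (e := e) fun i => by
      calc ∫ x in Ω, deriv ψ (u x) * |Du x i| ^ p i ≤ ∫ x in Ω, c * |Du x i| ^ p i :=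
            integral_mono (integrable_deriv_cutoff_mul hu.aemeasurable hψ (hint i))
              ((hint i).const_mul c) fun x => mul_le_mul_of_nonneg_right (hψ.deriv_le _)
                (Real.rpow_nonneg (abs_nonneg _) _)
        _ ≤ e := by
            rw [integral_const_mul]
            exact mul_le_mul_of_nonneg_left
              (Finset.single_le_sum (fun i _ => hnn i) (Finset.mem_univ i)) hc.le
    rw [Real.mul_rpow hc.le (distrib_nonneg _ _ _)] at this
    calc _ = (2 * k - k) * distrib Ω u (2 * k) ^ (1 - 1 / (N : ℝ)) := by ring
      _ ≤ _ := this
      _ = _ := by ring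
  obtain ⟨M, -, hM⟩ := exists_le_two_pow_of_mul_rpow_le (distrib_nonneg Ω u)
    (θ := 1 - 1 / (N : ℝ)) (τ := 1 - (pbar p)⁻¹) (by linarith) (by rw [one_div]; linarith)
    (by positivity) hstep
  refine integrable_rpow_of_measure_le hu.aemeasurable hM hr ?_
  convert! hrp using 1
  have := pbar_pos hN0 hp
  have : (N : ℝ) - pbar p ≠ 0 := by linarith
  have h2 : 1 - 1 / (N : ℝ) - (1 - (pbar p)⁻¹) ≠ 0 := by rw [one_div]; linarith
  rw [pstar, div_eq_div_iff h2 this]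
  field_simp
  ring

/-- The Poincaré inequality in the direction `i`, in the limit. -/
lemma MemW0.memLp (hΩ : Bornology.IsBounded Ω) (hp : ∀ i, 1 < p i) (hu : MemW0 Ω p u Du)
    (i : Fin N) : MemLp u (ENNReal.ofReal (p i)) (volume.restrict Ω) := by
  have hpi : 0 < p i := by linarith [hp i]
  have hne : ENNReal.ofReal (p i) ≠ 0 := by simpa using hpi
  obtain ⟨C, hC0, hC⟩ := integral_rpow_le_of_isTest hΩ (hp i) i
  obtain ⟨φ, hφ, hae, hgrad⟩ := hu.exists_approx
  have hbound : ∀ n, eLpNorm (φ n) (ENNReal.ofReal (p i)) (volume.restrict Ω) ≤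
      ENNReal.ofReal (C ^ (p i)⁻¹) *
        eLpNorm (partialDeriv i (φ n)) (ENNReal.ofReal (p i)) (volume.restrict Ω) := fun n => by
    rw [((hφ n).memLp _).eLpNorm_eq_integral_rpow_norm hne ENNReal.ofReal_ne_top,
      ((hφ n).memLp_partialDeriv i _).eLpNorm_eq_integral_rpow_norm hne ENNReal.ofReal_ne_top,
      ← ENNReal.ofReal_mul (by positivity), ENNReal.toReal_ofReal hpi.le]
    refine ENNReal.ofReal_le_ofReal ?_
    rw [← Real.mul_rpow hC0 (integral_nonneg fun x => by positivity)]
    refine Real.rpow_le_rpow (integral_nonneg fun x => by positivity) ?_ (by positivity)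
    have h := hC _ (hφ n)
    rw [setIntegral_eq_integral_of_forall_compl_eq_zero,
      setIntegral_eq_integral_of_forall_compl_eq_zero]
    · exact h
    · intro x hx
      have : partialDeriv i (φ n) x = 0 := by
        by_contra h0
        exact hx ((hφ n).support_partialDeriv_subset i h0)
      simp [this, hpi.ne']
    · intro x hx
      have : φ n x = 0 := by
        by_contra h0
        exact hx ((hφ n).support_subset (subset_tsupport _ h0))
      simp [this, hpi.ne']
  refine ⟨hu.memLp_one.1, ?_⟩
  refine (Lp.eLpNorm_lim_le_liminf_eLpNorm (fun n => ((hφ n).memLp 1).1) u hae).trans_lt ?_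
  have hev : ∀ᶠ n in atTop, eLpNorm (φ n) (ENNReal.ofReal (p i)) (volume.restrict Ω) ≤
      ENNReal.ofReal (C ^ (p i)⁻¹) *
        (1 + eLpNorm (fun x => Du x i) (ENNReal.ofReal (p i)) (volume.restrict Ω)) := by
    filter_upwards [(hgrad i).eventually_le_const zero_lt_one] with n hn
    refine (hbound n).trans (mul_le_mul_right ?_ _)
    calc eLpNorm (partialDeriv i (φ n)) (ENNReal.ofReal (p i)) (volume.restrict Ω)
        = eLpNorm ((fun x => partialDeriv i (φ n) x - Du x i) + fun x => Du x i)
          (ENNReal.ofReal (p i)) (volume.restrict Ω) := by congr 1; ext x; simp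
      _ ≤ _ := eLpNorm_add_le ((((hφ n).memLp_partialDeriv i _).sub (hu.memLp_grad i)).1)
          (hu.memLp_grad i).1 (by simpa using (hp i).le)
      _ ≤ _ := by gcongr
  refine (liminf_le_of_frequently_le' hev.frequently).trans_lt ?_
  exact ENNReal.mul_lt_top ENNReal.ofReal_lt_top
    (ENNReal.add_lt_top.2 ⟨ENNReal.one_lt_top, (hu.memLp_grad i).2⟩)

theorem MemW0.integrable_rpow_of_lt_pinfty (hN : 2 ≤ N) (hΩ : Bornology.IsBounded Ω)
    [IsFiniteMeasure (volume.restrict Ω)]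
    (hp : ∀ i, 1 < p i) (hpN : pbar p < N) (hu : MemW0 Ω p u Du) {r : ℝ} (hr : 0 ≤ r)
    (hrp : r < pinfty p) : Integrable (fun x => |u x| ^ r) (volume.restrict Ω) := by
  rcases lt_max_iff.1 hrp with h | h
  · exact hu.integrable_rpow_of_lt_pstar hN hp hpN hr h
  have : Nonempty (Fin N) := ⟨⟨0, by omega⟩⟩
  obtain ⟨i, hi⟩ := exists_eq_ciSup_of_finite (f := p)
  rw [← hi] at h
  rcases hr.eq_or_lt with rfl | hr
  · simp
  exact integrable_abs_rpow hr ((hu.memLp hΩ hp i).mono_exponent (ENNReal.ofReal_le_ofReal h.le))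

end

/-! ### Superposition operators and integrability of the terms of the equation -/

/-- A Carathéodory function is measurable along measurable functions: approximate the inner
function by simple functions. -/
lemma IsCaratheodory.aemeasurable_comp {N : ℕ} {X : Type} [NormedAddCommGroup X]
    [SecondCountableTopology X] [MeasurableSpace X] [BorelSpace X] {Ω : Set (E N)}
    {h : E N → X → ℝ} (hh : IsCaratheodory Ω h) {v : E N → X}
    (hv : AEMeasurable v (volume.restrict Ω)) :
    AEMeasurable (fun x => h x (v x)) (volume.restrict Ω) := by
  set w := hv.mk v with hw
  have hwm : Measurable w := hv.measurable_mk
  let s : ℕ → SimpleFunc (E N) X := fun n => SimpleFunc.approxOn w hwm Set.univ 0 (Set.mem_univ _) n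
  have hs : ∀ x, Tendsto (fun n => s n x) atTop (𝓝 (w x)) := fun x =>
    SimpleFunc.tendsto_approxOn hwm (Set.mem_univ _) (by simp)
  refine aemeasurable_of_tendsto_metrizable_ae atTop (f := fun n x => h x (s n x)) (fun n => ?_) ?_
  · have : (fun x => h x (s n x)) = fun x =>
        ∑ ξ ∈ (s n).range, (s n ⁻¹' {ξ}).indicator (fun x => h x ξ) x := by
      ext x
      rw [Finset.sum_eq_single (s n x)]
      · rw [Set.indicator_of_mem (by simp)]
      · intro ξ _ hne
        exact Set.indicator_of_notMem (fun hx => hne hx.symm) _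
      · intro hx
        exact absurd ((s n).mem_range_self x) hx
    rw [this]
    exact Finset.aemeasurable_fun_sum _ fun ξ _ =>
      (hh.measurable ξ).indicator ((s n).measurableSet_fiber ξ)
  · filter_upwards [hh.continuous, hv.ae_eq_mk] with x hx hvx
    rw [hvx]
    exact (hx.tendsto _).comp (hs x)

lemma memLp_of_integrable_rpow {X : Type*} [MeasurableSpace X] {μ : Measure X} {r : ℝ} (hr : 0 < r)
    {f : X → ℝ} (hf : AEMeasurable f μ) (hi : Integrable (fun x => |f x| ^ r) μ) :
    MemLp f (ENNReal.ofReal r) μ := by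
  rw [← integrable_norm_rpow_iff hf.aestronglyMeasurable (by simpa using hr) ENNReal.ofReal_ne_top]
  simpa [ENNReal.toReal_ofReal hr.le] using hi

lemma MemW0.aemeasurable_grad {N : ℕ} {Ω : Set (E N)} {p : Fin N → ℝ} {u : E N → ℝ}
    {Du : E N → E N} (hu : MemW0 Ω p u Du) : AEMeasurable Du (volume.restrict Ω) := by
  have h : AEMeasurable (fun x i => Du x i) (volume.restrict Ω) :=
    aemeasurable_pi_lambda _ fun i => (hu.memLp_grad i).1.aemeasurable
  exact (PiLp.volume_preserving_toLp (Fin N)).measurable.comp_aemeasurable h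

lemma holderConjugate_conj {r : ℝ} (hr : 1 < r) : r.HolderConjugate (conj r) :=
  Real.HolderConjugate.conjExponent hr

section

variable {N : ℕ} {Ω : Set (E N)} {p : Fin N → ℝ} {u : E N → ℝ} {Du : E N → E N}

lemma H1.memLp_comp {α : ℝ} {β : Fin N → ℝ} {A : Fin N → E N → E N → ℝ} (hp : ∀ i, 1 < p i)
    (hA : H1 Ω p α β A) (hu : MemW0 Ω p u Du) (i : Fin N) :
    MemLp (fun x => A i x (Du x)) (ENNReal.ofReal (conj (p i))) (volume.restrict Ω) := by
  have hc := holderConjugate_conj (hp i)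
  have hpi := hc.pos
  have hm := (hA.caratheodory i).aemeasurable_comp hu.aemeasurable_grad
  have hβ : 0 ≤ β i := hA.alpha_pos.le.trans (hA.alpha_le i)
  refine memLp_of_integrable_rpow hc.symm.pos hm ?_
  refine ((integrable_abs_rpow hpi (hu.memLp_grad i)).const_mul (β i ^ conj (p i))).mono'
    (hm.abs.pow_const _).aestronglyMeasurable ?_
  filter_upwards [hA.growth i] with x hx
  rw [Real.norm_eq_abs, abs_of_nonneg (by positivity)]
  have h1 : (|Du x i| ^ (p i - 1)) ^ conj (p i) = |Du x i| ^ p i := by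
    rw [← Real.rpow_mul (abs_nonneg _), conj]
    congr 1
    have := hc.sub_one_ne_zero
    field_simp
  rw [← h1, ← Real.mul_rpow hβ (by positivity)]
  exact Real.rpow_le_rpow (abs_nonneg _) (hx _) hc.symm.nonneg

lemma le_conj_ratio_of_mu (s : Fin N → ℝ) (i : Fin N) : mu p s ≤ s i / conj (p i) :=
  ciInf_le (Set.finite_range _).bddBelow i

lemma one_lt_mu (hN : 0 < N) (hp : ∀ i, 1 < p i) (hpN : pbar p < N) {s : Fin N → ℝ}
    (hs : (N : ℝ) / pbar p < mu p s) : 1 < mu p s :=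
  ((one_lt_div (pbar_pos hN hp)).2 hpN).trans hs

lemma conj_lt_of_mu (hN : 0 < N) (hp : ∀ i, 1 < p i) (hpN : pbar p < N) {s : Fin N → ℝ}
    (hs : (N : ℝ) / pbar p < mu p s) (i : Fin N) : conj (p i) < s i := by
  have h := (one_lt_mu hN hp hpN hs).trans_le (le_conj_ratio_of_mu s i)
  exact (one_lt_div (holderConjugate_conj (hp i)).symm.pos).1 h

/-- Since `s_i / p_i' > N / p̄`, the conjugate exponent of `s_i / p_i'` is less than `p̄* / p̄`, and
`b_i^{p_i'} |u|^{p̄}` is integrable. -/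
lemma H2.memLp_comp (hN : 2 ≤ N) [IsFiniteMeasure (volume.restrict Ω)] (hΩ : MeasurableSet Ω)
    (hp : ∀ i, 1 < p i) (hpN : pbar p < N) {s : Fin N → ℝ} (hs : (N : ℝ) / pbar p < mu p s)
    {b : Fin N → E N → ℝ} {B : Fin N → E N → ℝ → ℝ} (hB : H2 Ω p b B)
    (hb : ∀ i, MemLp (b i) (ENNReal.ofReal (s i)) (volume.restrict Ω))
    (hu : MemW0 Ω p u Du) (i : Fin N) :
    MemLp (fun x => B i x (u x)) (ENNReal.ofReal (conj (p i))) (volume.restrict Ω) := by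
  have hN0 : 0 < N := by omega
  have hNR : (0 : ℝ) < N := by exact_mod_cast hN0
  have hpb := pbar_pos hN0 hp
  have hc := holderConjugate_conj (hp i)
  have hq := hc.symm.pos
  set q := conj (p i)
  have hm := (hB.caratheodory i).aemeasurable_comp hu.aemeasurable
  have hms : (N : ℝ) / pbar p < s i / q := hs.trans_le (le_conj_ratio_of_mu s i)
  have hNp : 1 < (N : ℝ) / pbar p := (one_lt_div hpb).2 hpN
  have hm1 : 1 < s i / q := hNp.trans hms
  have hsi : 0 < s i := by
    have := conj_lt_of_mu hN0 hp hpN hs i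
    exact hq.trans this
  have hr := holderConjugate_conj hm1
  set r := conj (s i / q) with hrdef
  -- `1 / r = 1 - p_i' / s_i > 1 - p̄ / N = p̄ / p̄*`.
  have hrp : pbar p * r < pstar p := by
    have hd : 0 < (N : ℝ) - pbar p := by linarith
    have hd' : 0 < s i / q - 1 := by linarith
    have h1 : (N : ℝ) < s i / q * pbar p := (div_lt_iff₀ hpb).1 hms
    rw [hrdef, conj, pstar, ← mul_div_assoc, div_lt_div_iff₀ hd' hd]
    nlinarith
  have hi1 := integrable_abs_rpow hsi (hb i)
  have hi2 := hu.integrable_rpow_of_lt_pstar hN hp hpN (mul_pos hpb hr.symm.pos).le hrp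
  refine memLp_of_integrable_rpow hq hm ?_
  refine (hi1.add hi2).mono' (hm.abs.pow_const _).aestronglyMeasurable ?_
  filter_upwards [hB.growth i, ae_restrict_mem hΩ] with x hx hxΩ
  have hb0 := hB.coeff_nonneg i x hxΩ
  rw [Real.norm_eq_abs, abs_of_nonneg (by positivity)]
  have h1 := Real.young_inequality_of_nonneg (Real.rpow_nonneg hb0 q)
    (Real.rpow_nonneg (abs_nonneg (u x)) (pbar p)) hr
  rw [← Real.rpow_mul hb0, ← Real.rpow_mul (abs_nonneg _), mul_div_cancel₀ _ hq.ne'] at h1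
  have h2 : b i x ^ s i / (s i / q) ≤ b i x ^ s i := div_le_self (by positivity) hm1.le
  have h3 : |u x| ^ (pbar p * r) / r ≤ |u x| ^ (pbar p * r) :=
    div_le_self (by positivity) hr.symm.lt.le
  calc |B i x (u x)| ^ q ≤ (b i x * |u x| ^ (pbar p / q)) ^ q :=
        Real.rpow_le_rpow (abs_nonneg _) (hx _) hq.le
    _ = b i x ^ q * |u x| ^ pbar p := by
        rw [Real.mul_rpow hb0 (by positivity), ← Real.rpow_mul (abs_nonneg _),
          div_mul_cancel₀ _ hq.ne']
    _ ≤ |b i x| ^ s i + |u x| ^ (pbar p * r) := by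
        rw [abs_of_nonneg hb0]; linarith

lemma H3.integrable_comp (hN : 2 ≤ N) (hΩ : Bornology.IsBounded Ω)
    [IsFiniteMeasure (volume.restrict Ω)] (hp : ∀ i, 1 < p i) (hpN : pbar p < N) {m γ : ℝ}
    {G : E N → ℝ → ℝ} (hG : H3 Ω p m γ G) (hu : MemW0 Ω p u Du) :
    Integrable (fun x => G x (u x)) (volume.restrict Ω) := by
  have hi := hu.integrable_rpow_of_lt_pinfty hN hΩ hp hpN (r := γ) (by linarith [hG.one_le])
    (by linarith [hG.lt_pinfty])
  refine (hi.const_mul m).mono'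
    (hG.caratheodory.aemeasurable_comp hu.aemeasurable).aestronglyMeasurable ?_
  filter_upwards [hG.growth] with x hx using hx _

/-! ### The energy estimate -/

lemma integrable_mul_of_memLp {X : Type*} [MeasurableSpace X] {μ : Measure X} {r q : ℝ}
    (hrq : r.HolderConjugate q) {f g : X → ℝ} (hf : MemLp f (ENNReal.ofReal q) μ)
    (hg : MemLp g (ENNReal.ofReal r) μ) : Integrable (fun x => f x * g x) μ := by
  have := holderTriple_ofReal hrq.symm
  exact memLp_one_iff_integrable.1 (hg.mul hf)

/-- An equation tested with all of `C_0^∞(Ω)` may be tested with smooth truncations of `u`, whose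
gradients are `ψ'(u) ∇u`. -/
lemma MemW0.weak_eq_cutoff [IsFiniteMeasure (volume.restrict Ω)] (hp : ∀ i, 1 < p i)
    (hu : MemW0 Ω p u Du) {F : Fin N → E N → ℝ} {g : E N → ℝ}
    (hF : ∀ i, MemLp (F i) (ENNReal.ofReal (conj (p i))) (volume.restrict Ω))
    (hg : Integrable g (volume.restrict Ω))
    (heq : ∀ φ, IsTest Ω φ →
      (∑ i, ∫ x in Ω, F i x * partialDeriv i φ x) + ∫ x in Ω, g x * φ x = 0)
    {c k h : ℝ} {ψ : ℝ → ℝ} (hψ : IsCutoff c k h ψ) :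
    (∑ i, ∫ x in Ω, F i x * (deriv ψ (u x) * Du x i)) + ∫ x in Ω, g x * ψ (u x) = 0 := by
  obtain ⟨φ, hφ, hae, hgrad⟩ := hu.exists_approx
  have hcont := hψ.smooth.continuous
  have h1 : ∀ i, Tendsto (fun n => ∫ x in Ω, F i x * partialDeriv i (ψ ∘ φ n) x) atTop
      (𝓝 (∫ x in Ω, F i x * (deriv ψ (u x) * Du x i))) := fun i => by
    refine (tendsto_integral_mul_mul (μ := volume.restrict Ω) (w := fun x => deriv ψ (u x))
      (Fn := fun n => partialDeriv i (φ n)) (wn := fun n x => deriv ψ (φ n x)) (L := c)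
      (holderConjugate_conj (hp i)) (hF i) (hu.memLp_grad i)
      (fun n => (hφ n).memLp_partialDeriv i _) (hgrad i)
      (fun n => (hψ.continuous_deriv.comp (hφ n).smooth.continuous).aestronglyMeasurable)
      (fun n x => hψ.abs_deriv_le _) ?_).congr fun n => ?_
    · filter_upwards [hae] with x hx using (hψ.continuous_deriv.tendsto _).comp hx
    · simp only [(hφ n).partialDeriv_comp hψ.smooth]
  have h2 : Tendsto (fun n => ∫ x in Ω, g x * (ψ ∘ φ n) x) atTop
      (𝓝 (∫ x in Ω, g x * ψ (u x))) := by
    refine tendsto_integral_of_dominated_convergence (fun x => ‖g x‖ * (h - k)) (fun n => ?_)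
      (hg.norm.mul_const _) (fun n => Eventually.of_forall fun x => ?_) ?_
    · exact hg.1.mul (hcont.comp (hφ n).smooth.continuous).aestronglyMeasurable
    · rw [norm_mul]
      exact mul_le_mul_of_nonneg_left (hψ.abs_le _) (norm_nonneg _)
    · filter_upwards [hae] with x hx using ((hcont.tendsto _).comp hx).const_mul _
  have h3 := (tendsto_finsetSum Finset.univ fun i _ => h1 i).add h2
  refine tendsto_nhds_unique h3 (tendsto_const_nhds.congr fun n => ?_)
  exact (heq _ ((hφ n).comp hψ.smooth hψ.zero)).symm

/-- The density `∑ (|b_i|^{p_i'} + |f_i|^{p_i'})` of the data. -/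
noncomputable def dataDensity (p : Fin N → ℝ) (b f : Fin N → E N → ℝ) (x : E N) : ℝ :=
  ∑ i, (|b i x| ^ conj (p i) + |f i x| ^ conj (p i))

lemma dataDensity_nonneg (p : Fin N → ℝ) (b f : Fin N → E N → ℝ) (x : E N) :
    0 ≤ dataDensity p b f x :=
  Finset.sum_nonneg fun i _ => by positivity

/-- The integral of `g` over the part of `Ω` where `k < |u| < h`. -/
noncomputable def slabIntegral (Ω : Set (E N)) (u g : E N → ℝ) (k h : ℝ) : ℝ :=
  ∫ x in Ω, {x | k < |u x| ∧ |u x| < h}.indicator g x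

lemma nullMeasurableSet_slab (hu : AEMeasurable u (volume.restrict Ω)) (k h : ℝ) :
    NullMeasurableSet {x | k < |u x| ∧ |u x| < h} (volume.restrict Ω) :=
  (nullMeasurableSet_lt aemeasurable_const hu.abs).inter
    (nullMeasurableSet_lt hu.abs aemeasurable_const)

lemma integral_deriv_cutoff_mul_le (hu : AEMeasurable u (volume.restrict Ω)) {c k h : ℝ}
    {ψ : ℝ → ℝ} (hψ : IsCutoff c k h ψ) {g : E N → ℝ} (hg0 : ∀ x, 0 ≤ g x)
    (hg : Integrable g (volume.restrict Ω)) :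
    ∫ x in Ω, deriv ψ (u x) * g x ≤ c * slabIntegral Ω u g k h := by
  rw [slabIntegral, ← integral_const_mul]
  refine integral_mono (integrable_deriv_cutoff_mul hu hψ hg)
    ((hg.indicator₀ (nullMeasurableSet_slab hu k h)).const_mul c) fun x => ?_
  by_cases hx : x ∈ {x | k < |u x| ∧ |u x| < h}
  · simp only [Set.indicator_of_mem hx]
    exact mul_le_mul_of_nonneg_right (hψ.deriv_le _) (hg0 x)
  · simp only [Set.indicator_of_notMem hx, mul_zero]
    by_contra hne
    exact hx (hψ.deriv_ne _ fun h0 => hne (by rw [h0, zero_mul]))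

/-- The energy estimate: testing with a truncation at levels `1 ≤ k < h`, the zero-order term has a
sign, and Young's inequality absorbs the gradient. No smallness of the `b_i` is needed since `|u|`
is bounded by `h` where the test function varies. -/
theorem energy_le (hN : 2 ≤ N) (hΩm : MeasurableSet Ω) (hΩ : Bornology.IsBounded Ω)
    [IsFiniteMeasure (volume.restrict Ω)] (hp : ∀ i, 1 < p i) (hpN : pbar p < N)
    {s : Fin N → ℝ} (hs : (N : ℝ) / pbar p < mu p s)
    {α K : ℝ} (hK0 : 0 ≤ K)
    (hK : ∀ i, ∀ x y : ℝ, 0 ≤ x → 0 ≤ y → x * y ≤ α / 4 * x ^ p i + K * y ^ conj (p i))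
    {β : Fin N → ℝ} {A : Fin N → E N → E N → ℝ} {b : Fin N → E N → ℝ} {B : Fin N → E N → ℝ → ℝ}
    {m γ : ℝ} {G : E N → ℝ → ℝ} {f : Fin N → E N → ℝ}
    (hA : H1 Ω p α β A) (hB : H2 Ω p b B) (hG : H3 Ω p m γ G)
    (hb : ∀ i, MemLp (b i) (ENNReal.ofReal (s i)) (volume.restrict Ω))
    (hf : ∀ i, MemLp (f i) (ENNReal.ofReal (s i)) (volume.restrict Ω))
    (hu : MemW0 Ω p u Du)
    (heq : ∀ φ, IsTest Ω φ →
      ∫ x in Ω, ((∑ i, (A i x (Du x) + B i x (u x)) * partialDeriv i φ x) + G x (u x) * φ x)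
        = divFunctional Ω f φ)
    {c k h : ℝ} (hk : 1 ≤ k) (hkh : k < h) {ψ : ℝ → ℝ} (hψ : IsCutoff c k h ψ) (i : Fin N) :
    ∫ x in Ω, deriv ψ (u x) * |Du x i| ^ p i ≤
      2 / α * (K * h ^ pbar p * (c * slabIntegral Ω u (dataDensity p b f) k h)) := by
  have hN0 : 0 < N := by omega
  have hα := hA.alpha_pos
  have hpb := pbar_pos hN0 hp
  have hh1 : 1 ≤ h := by linarith
  have hqs : ∀ i, conj (p i) < s i := conj_lt_of_mu hN0 hp hpN hs
  have hq : ∀ i, 0 < conj (p i) := fun i => (holderConjugate_conj (hp i)).symm.pos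
  have hAm := fun i => hA.memLp_comp hp hu i
  have hBm := fun i => hB.memLp_comp hN hΩm hp hpN hs hb hu i
  have hbm : ∀ i, MemLp (b i) (ENNReal.ofReal (conj (p i))) (volume.restrict Ω) := fun i =>
    (hb i).mono_exponent (ENNReal.ofReal_le_ofReal (hqs i).le)
  have hfm : ∀ i, MemLp (f i) (ENNReal.ofReal (conj (p i))) (volume.restrict Ω) := fun i =>
    (hf i).mono_exponent (ENNReal.ofReal_le_ofReal (hqs i).le)
  have hGi := hG.integrable_comp hN hΩ hp hpN hu
  -- The terms are integrable one by one, so that the integral in the definition of a weak solution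
  -- may be split.
  set F : Fin N → E N → ℝ := fun i x => A i x (Du x) + B i x (u x) - f i x with hFdef
  have hFm : ∀ i, MemLp (F i) (ENNReal.ofReal (conj (p i))) (volume.restrict Ω) := fun i =>
    ((hAm i).add (hBm i)).sub (hfm i)
  have hweak : ∀ φ, IsTest Ω φ →
      (∑ i, ∫ x in Ω, F i x * partialDeriv i φ x) + ∫ x in Ω, G x (u x) * φ x = 0 := by
    intro φ hφ
    have hd := fun i => hφ.memLp_partialDeriv i (ENNReal.ofReal (p i))
    have i1 : ∀ i, Integrable (fun x => (A i x (Du x) + B i x (u x)) * partialDeriv i φ x)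
        (volume.restrict Ω) := fun i =>
      integrable_mul_of_memLp (holderConjugate_conj (hp i)) ((hAm i).add (hBm i)) (hd i)
    have i2 : ∀ i, Integrable (fun x => f i x * partialDeriv i φ x) (volume.restrict Ω) := fun i =>
      integrable_mul_of_memLp (holderConjugate_conj (hp i)) (hfm i) (hd i)
    obtain ⟨M, hM⟩ := hφ.smooth.continuous.bounded_above_of_compact_support hφ.compact_support
    have i3 : Integrable (fun x => G x (u x) * φ x) (volume.restrict Ω) :=
      hGi.mul_bdd hφ.smooth.continuous.aestronglyMeasurable (Eventually.of_forall hM)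
    have h1 := heq φ hφ
    rw [integral_add (integrable_finsetSum _ fun i _ => i1 i) i3,
      integral_finsetSum _ fun i _ => i1 i, divFunctional] at h1
    have h2 : ∀ i, ∫ x in Ω, F i x * partialDeriv i φ x =
        (∫ x in Ω, (A i x (Du x) + B i x (u x)) * partialDeriv i φ x) -
          ∫ x in Ω, f i x * partialDeriv i φ x := fun i => by
      rw [← integral_sub (i1 i) (i2 i)]
      simp only [hFdef, sub_mul]
    simp only [h2, Finset.sum_sub_distrib]
    linarith
  have hcut := hu.weak_eq_cutoff hp hFm hGi hweak hψ
  have hG0 : 0 ≤ ∫ x in Ω, G x (u x) * ψ (u x) := by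
    refine integral_nonneg_of_ae ?_
    filter_upwards [hG.sign] with x hx
    rcases eq_or_ne (u x) 0 with h0 | h0
    · simp [h0, hψ.zero]
    · have h1 := mul_nonneg (hx (u x)) (hψ.mul_nonneg (u x))
      have h2 : 0 < u x * u x := mul_self_pos.2 h0
      refine nonneg_of_mul_nonneg_left (b := u x * u x) ?_ h2
      calc (0 : ℝ) ≤ _ := h1
        _ = _ := by ring
  have hle : ∑ i, ∫ x in Ω, F i x * (deriv ψ (u x) * Du x i) ≤ 0 := by linarith
  set gi : Fin N → E N → ℝ := fun i x => |b i x| ^ conj (p i) + |f i x| ^ conj (p i) with hgi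
  have hgi0 : ∀ i x, 0 ≤ gi i x := fun i x => by positivity
  have hgint : ∀ i, Integrable (gi i) (volume.restrict Ω) := fun i =>
    (integrable_abs_rpow (hq i) (hbm i)).add (integrable_abs_rpow (hq i) (hfm i))
  have hDint : ∀ i, Integrable (fun x => |Du x i| ^ p i) (volume.restrict Ω) := fun i =>
    integrable_abs_rpow (by linarith [hp i]) (hu.memLp_grad i)
  have j1 := fun i => integrable_deriv_cutoff_mul hu.aemeasurable hψ (hDint i)
  have j2 := fun i => integrable_deriv_cutoff_mul hu.aemeasurable hψ (hgint i)
  have j3 : ∀ i, Integrable (fun x => F i x * (deriv ψ (u x) * Du x i)) (volume.restrict Ω) :=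
    fun i => by
      have := integrable_deriv_cutoff_mul hu.aemeasurable hψ
        (integrable_mul_of_memLp (holderConjugate_conj (hp i)) (hFm i) (hu.memLp_grad i))
      refine this.congr (Eventually.of_forall fun x => ?_)
      simp only; ring
  have hpt : ∀ i, α / 2 * (∫ x in Ω, deriv ψ (u x) * |Du x i| ^ p i) ≤
      (∫ x in Ω, F i x * (deriv ψ (u x) * Du x i)) +
        K * h ^ pbar p * ∫ x in Ω, deriv ψ (u x) * gi i x := fun i => by
    rw [← integral_const_mul, ← integral_const_mul,
      ← integral_add (j3 i) ((j2 i).const_mul _)]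
    refine integral_mono_ae ((j1 i).const_mul _) ((j3 i).add ((j2 i).const_mul _)) ?_
    filter_upwards [hA.coercive i, hB.growth i, ae_restrict_mem hΩm] with x hx1 hx2 hxΩ
    rcases (hψ.deriv_nonneg (u x)).eq_or_lt with h0 | h0
    · simp [← h0]
    have hb0 := hB.coeff_nonneg i x hxΩ
    have hux := (hψ.deriv_ne _ h0.ne').2
    have hupow : |u x| ^ pbar p ≤ h ^ pbar p := Real.rpow_le_rpow (abs_nonneg _) hux.le hpb.le
    have hhpow : 1 ≤ h ^ pbar p := Real.one_le_rpow hh1 hpb.le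
    have y1 := hK i |Du x i| (b i x * |u x| ^ (pbar p / conj (p i))) (abs_nonneg _) (by positivity)
    have y2 := hK i |Du x i| |f i x| (abs_nonneg _) (abs_nonneg _)
    rw [Real.mul_rpow hb0 (by positivity), ← Real.rpow_mul (abs_nonneg _),
      div_mul_cancel₀ _ (hq i).ne'] at y1
    have z1 : b i x ^ conj (p i) * |u x| ^ pbar p ≤ h ^ pbar p * |b i x| ^ conj (p i) := by
      rw [abs_of_nonneg hb0, mul_comm]
      exact mul_le_mul_of_nonneg_right hupow (by positivity)
    have z2 : |f i x| ^ conj (p i) ≤ h ^ pbar p * |f i x| ^ conj (p i) :=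
      le_mul_of_one_le_left (by positivity) hhpow
    have w1 := hx1 (Du x)
    have w2 : -(|Du x i| * (b i x * |u x| ^ (pbar p / conj (p i)))) ≤ B i x (u x) * Du x i := by
      have := neg_abs_le (B i x (u x) * Du x i)
      rw [abs_mul] at this
      have h5 := mul_le_mul_of_nonneg_left (hx2 (u x)) (abs_nonneg (Du x i))
      linarith
    have w3 : f i x * Du x i ≤ |Du x i| * |f i x| := by
      rw [← abs_mul, mul_comm]; exact le_abs_self _
    have main : α / 2 * |Du x i| ^ p i ≤ F i x * Du x i + K * h ^ pbar p * gi i x := by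
      have z1' := mul_le_mul_of_nonneg_left z1 hK0
      have z2' := mul_le_mul_of_nonneg_left z2 hK0
      simp only [hFdef, hgi]
      linarith
    calc α / 2 * (deriv ψ (u x) * |Du x i| ^ p i)
        = deriv ψ (u x) * (α / 2 * |Du x i| ^ p i) := by ring
      _ ≤ deriv ψ (u x) * (F i x * Du x i + K * h ^ pbar p * gi i x) :=
          mul_le_mul_of_nonneg_left main h0.le
      _ = _ := by ring
  have hsum := Finset.sum_le_sum fun i (_ : i ∈ Finset.univ) => hpt i
  rw [Finset.sum_add_distrib, ← Finset.mul_sum, ← Finset.mul_sum] at hsum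
  have hgsum : ∑ i, ∫ x in Ω, deriv ψ (u x) * gi i x ≤
      c * slabIntegral Ω u (dataDensity p b f) k h := by
    rw [← integral_finsetSum _ fun i _ => j2 i]
    simp only [← Finset.mul_sum]
    exact integral_deriv_cutoff_mul_le hu.aemeasurable hψ (dataDensity_nonneg p b f)
      (integrable_finsetSum _ fun i _ => hgint i)
  have hone := Finset.single_le_sum (f := fun i => ∫ x in Ω, deriv ψ (u x) * |Du x i| ^ p i)
    (fun i _ => integral_nonneg fun x => mul_nonneg (hψ.deriv_nonneg _) (by positivity))
    (Finset.mem_univ i)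
  have hKh : 0 ≤ K * h ^ pbar p := by positivity
  have hfin : α / 2 * (∫ x in Ω, deriv ψ (u x) * |Du x i| ^ p i) ≤
      K * h ^ pbar p * (c * slabIntegral Ω u (dataDensity p b f) k h) := by
    have h1 := mul_le_mul_of_nonneg_left hgsum hKh
    have h2 := mul_le_mul_of_nonneg_left hone (half_pos hα).le
    simp only at h2
    linarith
  calc _ = 2 / α * (α / 2 * ∫ x in Ω, deriv ψ (u x) * |Du x i| ^ p i) := by field_simp
    _ ≤ _ := mul_le_mul_of_nonneg_left hfin (by positivity)

end

/-! ### The level-set iteration -/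

/-- If the slab integrals over disjoint dyadic slabs are bounded in total by `Λ`, one of the first
`J` of them is at most `Λ / J`; the level sets above it are correspondingly small. -/
lemma exists_distrib_le {θ σ V D Λ δ : ℝ} (hθ : 0 < θ) (hσ : 0 < σ) (hσ1 : σ < 1) (hD : 0 ≤ D)
    (hδ : 0 < δ) :
    ∃ J : ℕ, ∀ (a : ℝ → ℝ) (I : ℝ → ℝ → ℝ), Antitone a → (∀ k, 0 ≤ a k) → (∀ k, a k ≤ V) →
      (∀ k h, 0 ≤ I k h) →
      (∀ k h, 1 ≤ k → k < h → (h - k) * a h ^ θ ≤ D * (h * (I k h ^ σ * a k ^ (1 - σ)))) →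
      (∀ J : ℕ, ∑ j ∈ Finset.range J, I (2 ^ j) (2 ^ (j + 1)) ≤ Λ) → a (2 ^ J) ≤ δ := by
  have hlim : Tendsto (fun J : ℕ => 2 * D * V ^ (1 - σ) * (Λ / J) ^ σ) atTop (𝓝 0) := by
    have := ((tendsto_const_div_atTop_nhds_zero_nat Λ).rpow_const (p := σ)
      (Or.inr hσ.le)).const_mul (2 * D * V ^ (1 - σ))
    simpa [Real.zero_rpow hσ.ne'] using this
  obtain ⟨J, hJ, hJ1⟩ := ((hlim.eventually_le_const (Real.rpow_pos_of_pos hδ θ)).and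
    (eventually_ge_atTop 1)).exists
  refine ⟨J, fun a I hanti ha0 haV hI0 hlevel hsum => ?_⟩
  have hJR : (0 : ℝ) < J := by exact_mod_cast hJ1
  obtain ⟨j, hj, hIj⟩ : ∃ j ∈ Finset.range J, I (2 ^ j) (2 ^ (j + 1)) ≤ Λ / J := by
    refine Finset.exists_le_of_sum_le (Finset.nonempty_range_iff.2 (by omega)) ?_
    rw [Finset.sum_const, Finset.card_range, nsmul_eq_mul, mul_div_cancel₀ _ hJR.ne']
    exact hsum J
  have h2j : (1 : ℝ) ≤ 2 ^ j := one_le_pow₀ (by norm_num)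
  have h1 := hlevel (2 ^ j) (2 ^ (j + 1)) h2j (pow_lt_pow_right₀ (by norm_num) (by omega))
  have hjJ : j + 1 ≤ J := Finset.mem_range.1 hj
  have h2 : a (2 ^ J) ≤ a (2 ^ (j + 1)) := hanti (pow_le_pow_right₀ (by norm_num) hjJ)
  have h3 : (2 : ℝ) ^ j * a (2 ^ (j + 1)) ^ θ ≤
      2 ^ j * (2 * D * V ^ (1 - σ) * (Λ / J) ^ σ) := by
    calc (2 : ℝ) ^ j * a (2 ^ (j + 1)) ^ θ = (2 ^ (j + 1) - 2 ^ j) * a (2 ^ (j + 1)) ^ θ := by ring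
      _ ≤ D * (2 ^ (j + 1) * (I (2 ^ j) (2 ^ (j + 1)) ^ σ * a (2 ^ j) ^ (1 - σ))) := h1
      _ ≤ D * (2 ^ (j + 1) * ((Λ / J) ^ σ * V ^ (1 - σ))) := by
          have e1 := Real.rpow_le_rpow (hI0 _ _) hIj hσ.le
          have e2 := Real.rpow_le_rpow (ha0 (2 ^ j)) (haV (2 ^ j)) (sub_nonneg.2 hσ1.le)
          have e3 : 0 ≤ a (2 ^ j) ^ (1 - σ) := Real.rpow_nonneg (ha0 _) _
          have e4 : 0 ≤ (Λ / J) ^ σ := (Real.rpow_nonneg (hI0 _ _) _).trans e1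
          gcongr
      _ = _ := by ring
  have h4 := (le_of_mul_le_mul_left h3 (by positivity)).trans hJ
  exact h2.trans ((Real.rpow_le_rpow_iff (ha0 _) hδ.le hθ).1 h4)

/-- De Giorgi's iteration on the levels `K (2 - 2^{-n})`: below a threshold `δ` for the measure at
level `K`, the superlinear recursion forces the measure at level `2 K` to vanish. -/
lemma exists_threshold {θ κ D : ℝ} (hθ : 0 < θ) (hκ : θ < κ) (hD : 0 ≤ D) :
    ∃ δ, 0 < δ ∧ ∀ (a : ℝ → ℝ) (K : ℝ), Antitone a → (∀ k, 0 ≤ a k) → 1 ≤ K →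
      (∀ k h, K ≤ k → k < h → (h - k) * a h ^ θ ≤ D * (h * a k ^ κ)) → a K ≤ δ →
      a (2 * K) = 0 := by
  set d := κ - θ with hd
  have hd0 : 0 < d := sub_pos.2 hκ
  -- The gain `r ^ (d n) = 2 ^ (-n)` compensates for the factor `h / (h - k) ≤ 2 ^ (n + 2)` of the
  -- `n`-th step; then `δ` is what the induction `a (k_n) ≤ δ r ^ n` requires.
  set r : ℝ := (1 / 2) ^ (1 / d) with hr
  have hr0 : 0 < r := by positivity
  have hr1 : r < 1 := Real.rpow_lt_one (by norm_num) (by norm_num) (by positivity)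
  have hrd : r ^ d = 1 / 2 := by
    rw [hr, ← Real.rpow_mul (by norm_num), one_div d, inv_mul_cancel₀ hd0.ne', Real.rpow_one]
  set δ : ℝ := (r ^ θ / (4 * D + 1)) ^ (1 / d) with hδ
  have hδ0 : 0 < δ := by positivity
  have hδd : 4 * D * δ ^ d ≤ r ^ θ := by
    rw [hδ, ← Real.rpow_mul (by positivity), one_div d, inv_mul_cancel₀ hd0.ne', Real.rpow_one,
      ← mul_div_assoc, div_le_iff₀ (by positivity)]
    nlinarith [Real.rpow_pos_of_pos hr0 θ]
  refine ⟨δ, hδ0, fun a K hanti ha0 hK1 hlevel haK => ?_⟩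
  have hK0 : 0 < K := by linarith
  have hmain : ∀ n : ℕ, a (K * (2 - (1 / 2) ^ n)) ≤ δ * r ^ n := by
    intro n
    induction n with
    | zero => norm_num; exact haK
    | succ n ih =>
      have hp0 : (0 : ℝ) < (1 / 2) ^ n := by positivity
      have hp1 : ((1 : ℝ) / 2) ^ n ≤ 1 := pow_le_one₀ (by norm_num) (by norm_num)
      have hps : ((1 : ℝ) / 2) ^ (n + 1) = (1 / 2) ^ n / 2 := by ring
      set k := K * (2 - (1 / 2) ^ n) with hk
      set h := K * (2 - (1 / 2) ^ (n + 1)) with hh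
      have hsub : h - k = K * ((1 / 2) ^ n / 2) := by rw [hh, hk, hps]; ring
      have hKk : K ≤ k := by rw [hk]; nlinarith
      have hkh : k < h := by rw [← sub_pos, hsub]; positivity
      have hh2 : h ≤ 2 * K := by rw [hh, hps]; nlinarith
      have h1 := hlevel k h hKk hkh
      rw [hsub] at h1
      have hB : 0 ≤ δ * r ^ n := by positivity
      rw [← Real.rpow_le_rpow_iff (ha0 _) (by positivity) hθ]
      have h2 : D * (h * a k ^ κ) ≤ D * (2 * K * (δ * r ^ n) ^ κ) := by
        have e1 := Real.rpow_le_rpow (ha0 k) ih (hθ.le.trans hκ.le)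
        have e2 : 0 ≤ a k ^ κ := Real.rpow_nonneg (ha0 k) _
        gcongr
      have h3 : (δ * r ^ n) ^ κ = (δ * r ^ n) ^ θ * (δ ^ d * (1 / 2) ^ n) := by
        have e : κ = θ + d := by rw [hd]; ring
        rw [e, Real.rpow_add_of_nonneg hB hθ.le hd0.le, Real.mul_rpow hδ0.le (by positivity) (z := d),
          ← Real.rpow_natCast r n, ← Real.rpow_mul hr0.le, mul_comm (n : ℝ) d,
          Real.rpow_mul hr0.le, hrd, Real.rpow_natCast, Real.rpow_natCast]
      have h4 : (δ * r ^ (n + 1)) ^ θ = (δ * r ^ n) ^ θ * r ^ θ := by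
        rw [← Real.mul_rpow hB hr0.le]; congr 1; ring
      rw [h3] at h2
      have h5 : K * ((1 / 2) ^ n / 2) * a h ^ θ ≤
          K * ((1 / 2) ^ n / 2) * ((δ * r ^ n) ^ θ * (4 * D * δ ^ d)) := by
        calc _ ≤ _ := h1.trans h2
          _ = _ := by ring
      rw [h4]
      exact (le_of_mul_le_mul_left h5 (by positivity)).trans
        (mul_le_mul_of_nonneg_left hδd (by positivity))
  have hlim : Tendsto (fun n : ℕ => δ * r ^ n) atTop (𝓝 0) := by
    simpa using (tendsto_pow_atTop_nhds_zero_of_lt_one hr0.le hr1).const_mul δ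
  refine le_antisymm (ge_of_tendsto' hlim fun n => ?_) (ha0 _)
  refine (hanti ?_).trans (hmain n)
  have : (0 : ℝ) < (1 / 2) ^ n := by positivity
  nlinarith

/-- The two steps together: smallness of some level set, then De Giorgi's iteration. The level
depends on the constants only. -/
lemma exists_vanishing_level {θ σ e V D Λ : ℝ} (hθ : 0 < θ) (hσ : 0 < σ) (hσ1 : σ < 1)
    (he : 0 ≤ e) (hκ : θ < 1 - σ + e * σ) (hD : 0 ≤ D) (hΛ : 0 ≤ Λ) :
    ∃ K, 0 < K ∧ ∀ (a : ℝ → ℝ) (I : ℝ → ℝ → ℝ), Antitone a → (∀ k, 0 ≤ a k) → (∀ k, a k ≤ V) →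
      (∀ k h, 0 ≤ I k h) →
      (∀ k h, 1 ≤ k → k < h → (h - k) * a h ^ θ ≤ D * (h * (I k h ^ σ * a k ^ (1 - σ)))) →
      (∀ k h, I k h ≤ Λ * a k ^ e) →
      (∀ J : ℕ, ∑ j ∈ Finset.range J, I (2 ^ j) (2 ^ (j + 1)) ≤ Λ) → a K = 0 := by
  obtain ⟨δ, hδ, hthr⟩ := exists_threshold hθ hκ (D := D * Λ ^ σ) (by positivity)
  obtain ⟨J, hJ⟩ := exists_distrib_le (Λ := Λ) hθ hσ hσ1 hD hδ
  refine ⟨2 * 2 ^ J, by positivity, fun a I hanti ha0 haV hI0 hlevel hI hsum => ?_⟩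
  have h1J : (1 : ℝ) ≤ 2 ^ J := one_le_pow₀ (by norm_num)
  refine hthr a (2 ^ J) hanti ha0 h1J (fun k h hk hkh => ?_)
    (hJ a I hanti ha0 haV hI0 hlevel hsum)
  refine (hlevel k h (h1J.trans hk) hkh).trans ?_
  have h1 : I k h ^ σ * a k ^ (1 - σ) ≤ Λ ^ σ * a k ^ (1 - σ + e * σ) := by
    have e1 := Real.rpow_le_rpow (hI0 k h) (hI k h) hσ.le
    rw [Real.mul_rpow hΛ (Real.rpow_nonneg (ha0 k) _), ← Real.rpow_mul (ha0 k)] at e1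
    rw [Real.rpow_add_of_nonneg (ha0 k) (sub_nonneg.2 hσ1.le) (by positivity)]
    calc _ ≤ Λ ^ σ * a k ^ (e * σ) * a k ^ (1 - σ) :=
          mul_le_mul_of_nonneg_right e1 (Real.rpow_nonneg (ha0 k) _)
      _ = _ := by ring
  have h0 : 0 ≤ h := by linarith
  calc _ ≤ D * (h * (Λ ^ σ * a k ^ (1 - σ + e * σ))) := by gcongr
    _ = _ := by ring

/-! ### Integrals of the data over level sets -/

section

variable {N : ℕ} {Ω : Set (E N)} {p : Fin N → ℝ} {u : E N → ℝ}

lemma setIntegral_abs_rpow_le {X : Type*} [MeasurableSpace X] {μ : Measure X} [IsFiniteMeasure μ]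
    {f : X → ℝ} {q s : ℝ} (hq : 0 < q) (hqs : q ≤ s) (hf : MemLp f (ENNReal.ofReal s) μ)
    (S : Set X) :
    ∫ x in S, |f x| ^ q ∂μ ≤
      (eLpNorm f (ENNReal.ofReal s) μ).toReal ^ q * μ.real S ^ (1 - q / s) := by
  have hs : 0 < s := hq.trans_le hqs
  have hne : ENNReal.ofReal q ≠ 0 := by simpa using hq
  have hfS : MemLp f (ENNReal.ofReal q) (μ.restrict S) :=
    (hf.mono_exponent (ENNReal.ofReal_le_ofReal hqs)).restrict S
  have hexp : 0 ≤ 1 / q - 1 / s := sub_nonneg.2 (one_div_le_one_div_of_le hq hqs)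
  have h1 := eLpNorm_le_eLpNorm_mul_rpow_measure_univ (ENNReal.ofReal_le_ofReal hqs)
    (hf.1.restrict (s := S))
  rw [ENNReal.toReal_ofReal hq.le, ENNReal.toReal_ofReal hs.le, Measure.restrict_apply_univ] at h1
  have h2 : eLpNorm f (ENNReal.ofReal q) (μ.restrict S) ≤
      eLpNorm f (ENNReal.ofReal s) μ * μ S ^ (1 / q - 1 / s) :=
    h1.trans (mul_le_mul_left (eLpNorm_mono_measure _ Measure.restrict_le_self) _)
  rw [hfS.eLpNorm_eq_integral_rpow_norm hne ENNReal.ofReal_ne_top, ENNReal.toReal_ofReal hq.le] at h2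
  have hI : 0 ≤ ∫ x in S, ‖f x‖ ^ q ∂μ := integral_nonneg fun x => by positivity
  have h3 := ENNReal.toReal_mono (ENNReal.mul_ne_top hf.2.ne
    (ENNReal.rpow_ne_top_of_nonneg hexp (measure_ne_top μ S))) h2
  rw [ENNReal.toReal_ofReal (by positivity), ENNReal.toReal_mul, ← ENNReal.toReal_rpow] at h3
  have h4 := Real.rpow_le_rpow (by positivity) h3 hq.le
  rw [← Real.rpow_mul hI, inv_mul_cancel₀ hq.ne', Real.rpow_one,
    Real.mul_rpow ENNReal.toReal_nonneg (by positivity), ← Real.rpow_mul ENNReal.toReal_nonneg] at h4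
  have h5 : (1 / q - 1 / s) * q = 1 - q / s := by field_simp
  rw [h5] at h4
  exact h4

lemma rpow_le_max_mul_rpow {t V e d : ℝ} (ht : 0 ≤ t) (htV : t ≤ V) (he : 0 ≤ e) (hed : e ≤ d)
    (hd1 : d ≤ 1) : t ^ d ≤ max 1 V * t ^ e := by
  have h1 : t ^ d = t ^ (d - e) * t ^ e := by
    rw [← Real.rpow_add_of_nonneg ht (by linarith) he]; congr 1; ring
  rw [h1]
  refine mul_le_mul_of_nonneg_right ?_ (Real.rpow_nonneg ht _)
  calc t ^ (d - e) ≤ max 1 V ^ (d - e) :=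
        Real.rpow_le_rpow ht (htV.trans (le_max_right _ _)) (by linarith)
    _ ≤ max 1 V ^ (1 : ℝ) := Real.rpow_le_rpow_of_exponent_le (le_max_left _ _) (by linarith)
    _ = max 1 V := Real.rpow_one _

/-- The bound for the data, in terms of the norms `nb i` and `nf i` and the measure `V` of `Ω`. -/
noncomputable def dataBound (p : Fin N → ℝ) (V : ℝ) (nb nf : Fin N → ℝ) : ℝ :=
  max 1 V * (max 1 V * ∑ i, (|nb i| ^ conj (p i) + |nf i| ^ conj (p i)))

lemma dataBound_nonneg (p : Fin N → ℝ) (V : ℝ) (nb nf : Fin N → ℝ) : 0 ≤ dataBound p V nb nf := by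
  have : 0 ≤ ∑ i, (|nb i| ^ conj (p i) + |nf i| ^ conj (p i)) :=
    Finset.sum_nonneg fun i _ => by positivity
  have : (0 : ℝ) ≤ max 1 V := zero_le_one.trans (le_max_left _ _)
  unfold dataBound
  positivity

lemma integrable_dataDensity [IsFiniteMeasure (volume.restrict Ω)] (hp : ∀ i, 1 < p i)
    {s : Fin N → ℝ} (hqs : ∀ i, conj (p i) ≤ s i) {b f : Fin N → E N → ℝ}
    (hb : ∀ i, MemLp (b i) (ENNReal.ofReal (s i)) (volume.restrict Ω))
    (hf : ∀ i, MemLp (f i) (ENNReal.ofReal (s i)) (volume.restrict Ω)) :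
    Integrable (dataDensity p b f) (volume.restrict Ω) :=
  integrable_finsetSum _ fun i _ =>
    (integrable_abs_rpow (holderConjugate_conj (hp i)).symm.pos
      ((hb i).mono_exponent (ENNReal.ofReal_le_ofReal (hqs i)))).add
    (integrable_abs_rpow (holderConjugate_conj (hp i)).symm.pos
      ((hf i).mono_exponent (ENNReal.ofReal_le_ofReal (hqs i))))

/-- Hölder's inequality, with the smallest of the exponents, `1 - 1 / μ`, for all the terms. -/
lemma setIntegral_dataDensity_le [IsFiniteMeasure (volume.restrict Ω)] (hp : ∀ i, 1 < p i)
    {s : Fin N → ℝ} (hmu : 1 < mu p s) {b f : Fin N → E N → ℝ}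
    (hb : ∀ i, MemLp (b i) (ENNReal.ofReal (s i)) (volume.restrict Ω))
    (hf : ∀ i, MemLp (f i) (ENNReal.ofReal (s i)) (volume.restrict Ω)) (S : Set (E N)) :
    ∫ x in S, dataDensity p b f x ∂(volume.restrict Ω) ≤
      max 1 ((volume.restrict Ω).real Set.univ) *
        (∑ i, (|lpNormOn Ω (s i) (b i)| ^ conj (p i) + |lpNormOn Ω (s i) (f i)| ^ conj (p i))) *
        (volume.restrict Ω).real S ^ (1 - 1 / mu p s) := by
  have hq : ∀ i, 0 < conj (p i) := fun i => (holderConjugate_conj (hp i)).symm.pos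
  have hqs : ∀ i, conj (p i) < s i := fun i =>
    (one_lt_div (hq i)).1 (hmu.trans_le (le_conj_ratio_of_mu s i))
  have hone : ∀ (i) {g : E N → ℝ}, MemLp g (ENNReal.ofReal (s i)) (volume.restrict Ω) →
      ∫ x in S, |g x| ^ conj (p i) ∂(volume.restrict Ω) ≤
        max 1 ((volume.restrict Ω).real Set.univ) * |lpNormOn Ω (s i) g| ^ conj (p i) *
          (volume.restrict Ω).real S ^ (1 - 1 / mu p s) := fun i g hg => by
    refine (setIntegral_abs_rpow_le (hq i) (hqs i).le hg S).trans ?_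
    rw [lpNormOn, abs_of_nonneg ENNReal.toReal_nonneg, mul_comm (max 1 _), mul_assoc]
    refine mul_le_mul_of_nonneg_left ?_ (by positivity)
    have hr : conj (p i) / s i ≤ 1 / mu p s := by
      rw [← inv_div, ← one_div]
      exact one_div_le_one_div_of_le (by linarith) (le_conj_ratio_of_mu s i)
    have hm1 : 1 / mu p s ≤ 1 := by rw [div_le_one (by linarith)]; exact hmu.le
    have hr0 : 0 ≤ conj (p i) / s i := div_nonneg (hq i).le ((hq i).trans (hqs i)).le
    exact rpow_le_max_mul_rpow measureReal_nonneg (measureReal_mono (Set.subset_univ _))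
      (by linarith) (by linarith) (by linarith)
  have hi : ∀ (i) {g : E N → ℝ}, MemLp g (ENNReal.ofReal (s i)) (volume.restrict Ω) →
      Integrable (fun x => |g x| ^ conj (p i)) ((volume.restrict Ω).restrict S) := fun i g hg =>
    (integrable_abs_rpow (hq i) (hg.mono_exponent
      (ENNReal.ofReal_le_ofReal (hqs i).le))).restrict
  have hadd : ∀ i, Integrable (fun x => |b i x| ^ conj (p i) + |f i x| ^ conj (p i))
      ((volume.restrict Ω).restrict S) := fun i => (hi i (hb i)).add (hi i (hf i))
  simp only [dataDensity]
  rw [integral_finsetSum _ fun i _ => hadd i, Finset.mul_sum,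
    Finset.sum_mul]
  refine Finset.sum_le_sum fun i _ => ?_
  rw [integral_add (hi i (hb i)) (hi i (hf i))]
  have h1 := hone i (hb i)
  have h2 := hone i (hf i)
  linarith

lemma slabIntegral_nonneg {g : E N → ℝ} (hg : ∀ x, 0 ≤ g x) (k h : ℝ) :
    0 ≤ slabIntegral Ω u g k h :=
  integral_nonneg fun x => Set.indicator_nonneg (fun x _ => hg x) x

lemma slabIntegral_le_setIntegral (hu : AEMeasurable u (volume.restrict Ω)) {g : E N → ℝ}
    (hg : ∀ x, 0 ≤ g x) (hgi : Integrable g (volume.restrict Ω)) (k h : ℝ) :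
    slabIntegral Ω u g k h ≤ ∫ x in {x | k < |u x|}, g x ∂(volume.restrict Ω) := by
  rw [slabIntegral, integral_indicator₀ (nullMeasurableSet_slab hu k h)]
  exact setIntegral_mono_set hgi.restrict (Eventually.of_forall hg)
    (Eventually.of_forall fun x hx => hx.1)

/-- The dyadic slabs are disjoint. -/
lemma sum_slabIntegral_le (hu : AEMeasurable u (volume.restrict Ω)) {g : E N → ℝ}
    (hg : ∀ x, 0 ≤ g x) (hgi : Integrable g (volume.restrict Ω)) (J : ℕ) :
    ∑ j ∈ Finset.range J, slabIntegral Ω u g (2 ^ j) (2 ^ (j + 1)) ≤ ∫ x in Ω, g x := by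
  have hi : ∀ j : ℕ, Integrable ({x | 2 ^ j < |u x| ∧ |u x| < 2 ^ (j + 1)}.indicator g)
      (volume.restrict Ω) := fun j => hgi.indicator₀ (nullMeasurableSet_slab hu _ _)
  have hpt : ∀ x, ∑ j ∈ Finset.range J,
      {x | 2 ^ j < |u x| ∧ |u x| < 2 ^ (j + 1)}.indicator g x ≤
        {x | |u x| < 2 ^ J}.indicator g x := fun x => by
    induction J with
    | zero => simpa using Set.indicator_nonneg (fun x _ => hg x) x
    | succ J ih =>
      rw [Finset.sum_range_succ]
      refine (add_le_add_left ih _).trans ?_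
      have hpow : (2 : ℝ) ^ J ≤ 2 ^ (J + 1) := pow_le_pow_right₀ (by norm_num) (by omega)
      by_cases h1 : |u x| < 2 ^ J
      · rw [Set.indicator_of_mem (show x ∈ {x | |u x| < 2 ^ J} from h1),
          Set.indicator_of_mem (show x ∈ {x | |u x| < 2 ^ (J + 1)} from h1.trans_le hpow),
          Set.indicator_of_notMem fun h => h.1.not_gt h1, add_zero]
      · rw [Set.indicator_of_notMem (show x ∉ {x | |u x| < 2 ^ J} from h1), zero_add]
        exact Set.indicator_le_indicator_of_subset (fun y hy => hy.2) (fun y => hg y) x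
  calc ∑ j ∈ Finset.range J, slabIntegral Ω u g (2 ^ j) (2 ^ (j + 1))
      = ∫ x in Ω, ∑ j ∈ Finset.range J,
          {x | 2 ^ j < |u x| ∧ |u x| < 2 ^ (j + 1)}.indicator g x :=
        (integral_finsetSum _ fun j _ => hi j).symm
    _ ≤ ∫ x in Ω, g x := integral_mono (integrable_finsetSum _ fun j _ => hi j) hgi fun x =>
        (hpt x).trans (Set.indicator_le_self' (fun y _ => hg y) x)

lemma eLpNorm_top_le_of_distrib_eq_zero [IsFiniteMeasure (volume.restrict Ω)] {K : ℝ}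
    (h : distrib Ω u K = 0) : eLpNorm u ⊤ (volume.restrict Ω) ≤ ENNReal.ofReal K := by
  have h0 : (volume.restrict Ω) {x | K < |u x|} = 0 :=
    (measureReal_eq_zero_iff (measure_ne_top _ _)).1 h
  rw [eLpNorm_exponent_top]
  refine eLpNormEssSup_le_of_ae_bound ?_
  rw [ae_iff]
  simpa using h0

end

end Aniso

theorem lemma4p2 (N : ℕ) (hN : 2 < N) (Ω : Set (Aniso.E N))
    (hΩ : Aniso.IsBoundedLipschitzDomain Ω)
    (p : Fin N → ℝ) (hp : ∀ i, 1 < p i) (hpN : Aniso.pbar p < N)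
    (s : Fin N → ℝ) (hs : (N : ℝ) / Aniso.pbar p < Aniso.mu p s)
    (α : ℝ) (hα : 0 < α) :
    ∃ C : (Fin N → ℝ) → (Fin N → ℝ) → ℝ, (∀ nb nf, 0 < C nb nf) ∧
      ∀ (β : Fin N → ℝ) (A : Fin N → Aniso.E N → Aniso.E N → ℝ)
        (b : Fin N → Aniso.E N → ℝ) (B : Fin N → Aniso.E N → ℝ → ℝ)
        (m γ : ℝ) (G : Aniso.E N → ℝ → ℝ) (f : Fin N → Aniso.E N → ℝ) (u : Aniso.E N → ℝ),
        Aniso.H1 Ω p α β A → Aniso.H2 Ω p b B → Aniso.H3 Ω p m γ G →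
        (∀ i, MemLp (b i) (ENNReal.ofReal (s i)) (volume.restrict Ω)) →
        (∀ i, MemLp (f i) (ENNReal.ofReal (s i)) (volume.restrict Ω)) →
        Aniso.IsWeakSolution Ω p A B G (Aniso.divFunctional Ω f) u →
        MemLp u ⊤ (volume.restrict Ω) ∧
          eLpNorm u ⊤ (volume.restrict Ω) ≤
            ENNReal.ofReal (C (fun i => Aniso.lpNormOn Ω (s i) (b i))
              (fun i => Aniso.lpNormOn Ω (s i) (f i))) := by
  have hN0 : 0 < N := by omega
  have hN2 : 2 ≤ N := hN.le
  have hNR : (0 : ℝ) < N := by exact_mod_cast hN0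
  have hΩm : MeasurableSet Ω := hΩ.isOpen.measurableSet
  have : IsFiniteMeasure (volume.restrict Ω) :=
    isFiniteMeasure_restrict.2 hΩ.isBounded.measure_lt_top.ne
  have hpb := Aniso.pbar_pos hN0 hp
  have hmu := Aniso.one_lt_mu hN0 hp hpN hs
  set σ := (Aniso.pbar p)⁻¹ with hσdef
  set e := 1 - 1 / Aniso.mu p s with hedef
  set V := (volume.restrict Ω).real Set.univ with hVdef
  have hσ : 0 < σ := Aniso.inv_pbar_pos hN0 hp
  have hσ1 : σ < 1 := Aniso.inv_pbar_lt_one hN0 hp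
  have he : 0 ≤ e := by rw [hedef, sub_nonneg, div_le_one (by linarith)]; exact hmu.le
  have hθ : 0 < 1 - 1 / (N : ℝ) := by
    rw [sub_pos, div_lt_one hNR]; exact_mod_cast (by omega : 1 < N)
  have hκ : 1 - 1 / (N : ℝ) < 1 - σ + e * σ := by
    have h1 : (N : ℝ) < Aniso.mu p s * Aniso.pbar p := (div_lt_iff₀ hpb).1 hs
    have h2 : 1 - σ + e * σ = 1 - 1 / (Aniso.mu p s * Aniso.pbar p) := by
      rw [hedef, hσdef]; field_simp; ring
    rw [h2]
    have := one_div_lt_one_div_of_lt hNR h1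
    linarith
  -- The constants of Young's inequality in the single directions are replaced by their sum.
  obtain ⟨K, hK0, hK⟩ : ∃ K, 0 ≤ K ∧ ∀ i, ∀ x y : ℝ, 0 ≤ x → 0 ≤ y →
      x * y ≤ α / 4 * x ^ p i + K * y ^ Aniso.conj (p i) := by
    choose Y hY0 hY using fun i => Aniso.exists_mul_le_rpow_add
      (Aniso.holderConjugate_conj (hp i)) (ε := α / 4) (by positivity)
    refine ⟨∑ i, Y i, Finset.sum_nonneg fun i _ => hY0 i, fun i x y hx hy => ?_⟩
    have := mul_le_mul_of_nonneg_right
      (Finset.single_le_sum (fun i _ => hY0 i) (Finset.mem_univ i))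
      (Real.rpow_nonneg hy (Aniso.conj (p i)))
    linarith [hY i x y hx hy]
  obtain ⟨c, hc, hex⟩ := Aniso.exists_isCutoff
  -- `D` collects the constants of the energy estimate and of the level-set inequality.
  set D : ℝ := N * ((2 / α * K * c) ^ σ * c ^ (1 - σ)) with hDdef
  have hD : 0 ≤ D := by positivity
  choose C hC0 hC using fun nb nf : Fin N → ℝ => Aniso.exists_vanishing_level hθ hσ hσ1 he hκ hD
    (V := V) (Aniso.dataBound_nonneg p V nb nf)
  refine ⟨C, hC0, fun β A b B m γ G f u hA hB hG hb hf hsol => ?_⟩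
  obtain ⟨Du, hu, heq⟩ := hsol
  set nb := fun i => Aniso.lpNormOn Ω (s i) (b i)
  set nf := fun i => Aniso.lpNormOn Ω (s i) (f i)
  set g := Aniso.dataDensity p b f
  have hg0 : ∀ x, 0 ≤ g x := Aniso.dataDensity_nonneg p b f
  have hgi : Integrable g (volume.restrict Ω) := Aniso.integrable_dataDensity hp
    (fun i => (Aniso.conj_lt_of_mu hN0 hp hpN hs i).le) hb hf
  have hS0 : 0 ≤ ∑ i, (|nb i| ^ Aniso.conj (p i) + |nf i| ^ Aniso.conj (p i)) :=
    Finset.sum_nonneg fun i _ => by positivity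
  have hV1 : 1 ≤ max 1 V := le_max_left _ _
  have hdata : ∀ S, ∫ x in S, g x ∂(volume.restrict Ω) ≤ max 1 V *
      (∑ i, (|nb i| ^ Aniso.conj (p i) + |nf i| ^ Aniso.conj (p i))) *
        (volume.restrict Ω).real S ^ e :=
    Aniso.setIntegral_dataDensity_le hp hmu hb hf
  have hzero : Aniso.distrib Ω u (C nb nf) = 0 := by
    refine hC nb nf (Aniso.distrib Ω u) (Aniso.slabIntegral Ω u g) (Aniso.distrib_antitone Ω u)
      (Aniso.distrib_nonneg Ω u) (Aniso.distrib_le Ω u) (Aniso.slabIntegral_nonneg hg0)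
      (fun k h hk hkh => ?_) (fun k h => ?_) fun J => ?_
    · obtain ⟨ψ, hψ⟩ := hex k h (by linarith) hkh
      have hI0 := Aniso.slabIntegral_nonneg (Ω := Ω) (u := u) hg0 k h
      have hh0 : 0 ≤ h := by linarith
      refine (hu.distrib_le_of_energy_le hN2 hp hkh hψ hc.le
        (Aniso.energy_le hN2 hΩm hΩ.isBounded hp hpN hs hK0 hK hA hB hG hb hf hu heq hk hkh
          hψ)).trans_eq ?_
      have e1 : 2 / α * (K * h ^ Aniso.pbar p * (c * Aniso.slabIntegral Ω u g k h)) =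
          2 / α * K * c * (h ^ Aniso.pbar p * Aniso.slabIntegral Ω u g k h) := by ring
      rw [e1, Real.mul_rpow (by positivity) (mul_nonneg (by positivity) hI0),
        Real.mul_rpow (by positivity) hI0, ← Real.rpow_mul hh0, mul_inv_cancel₀ hpb.ne',
        Real.rpow_one, Real.mul_rpow hc.le (Aniso.distrib_nonneg _ _ _), hDdef]
      ring
    · refine (Aniso.slabIntegral_le_setIntegral hu.aemeasurable hg0 hgi k h).trans
        ((hdata _).trans (mul_le_mul_of_nonneg_right ?_
          (Real.rpow_nonneg (Aniso.distrib_nonneg _ _ _) _)))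
      exact le_mul_of_one_le_left (by positivity) hV1
    · refine (Aniso.sum_slabIntegral_le hu.aemeasurable hg0 hgi J).trans ?_
      have h1 := hdata Set.univ
      rw [Measure.restrict_univ] at h1
      refine h1.trans ?_
      have h2 : V ^ e ≤ max 1 V := by
        have := Aniso.rpow_le_max_mul_rpow (t := V) (V := V) measureReal_nonneg le_rfl le_rfl he
          (by rw [hedef]; have : 0 < 1 / Aniso.mu p s := by positivity
              linarith)
        simpa using this
      rw [Aniso.dataBound, mul_comm (max 1 V) (max 1 V * _)]
      exact mul_le_mul_of_nonneg_left h2 (by positivity)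
  have hbound := Aniso.eLpNorm_top_le_of_distrib_eq_zero hzero
  exact ⟨⟨hu.memLp_one.1, hbound.trans_lt ENNReal.ofReal_lt_top⟩, hbound⟩
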